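/- Let $p$ be a prime and let $F$ be a field which contains a primitive $p$-th root of unity if $p$ is odd, and a primitive fourth root of unity if $p=2$. Suppose that there is $k\in\mathbb N$ such that $F$ contains a primitive $p^k$-th root of unity but no primitive $p^{k+1}$-th root of unity. Fix a separable closure $F_{sep}$ of $F$. For a field $K$ with $F\subseteq K\subseteq F_{sep}$ let $K(p)\subseteq F_{sep}$ be the compositum of all finite Galois extensions of $K$ of $p$-power degree inside $F_{sep}$, and let $G_K(p)=\mathrm{Gal}(K(p)/K)$, with the Krull topology, be the maximal pro-$p$ quotient of the absolute Galois group of $K$. Let $CR(F)\subseteq F_{sep}$ be the compositum of the fields $F(\sqrt[p^m]{a},\zeta_{p^m})$, where $a\in F^\times$ and $m\ge 1$. Let $\varphi\colon G_F(p)\to\mathbb Z_p^\times$ be the $p$-cyclotomic character, determined by $\sigma(\xi)=\xi^{\varphi(\sigma)}$ for all roots of unity $\xi$ of $p$-power order. Then the natural homomorphism $G_{CR(F)}(p)\to G_F(p)$, given by restricting automorphisms of $CR(F)(p)$ to $F(p)$, is injective and a homeomorphism onto a closed subgroup, and its image is the closed subgroup of $G_F(p)$ generated by all elements $$[\sigma,\tau]\,\tau^{1-\varphi(\sigma)},\qquad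 \sigma\in G_F(p),\ \tau\in\ker\varphi,$$ where $[\sigma,\tau]=\sigma\tau\sigma^{-1}\tau^{-1}$ and, for $z\in\mathbb Z_p$, $\tau^{z}$ is the limit of $\tau^{n}$ as the integer $n$ tends $p$-adically to $z$. -/

import Mathlib

open Filter Topology

/-- The maximal `p`-extension `K(p)` of a field `K` inside an overfield `Ω` (a separable closure
of `K` in all uses): the compositum of all finite Galois extensions of `p`-power degree. -/
def maximalPExtension (p : ℕ) (K Ω : Type*) [Field K] [Field Ω] [Algebra K Ω] :
    IntermediateField K Ω :=
  ⨆ E : {E : IntermediateField K Ω //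
    FiniteDimensional K E ∧ IsGalois K E ∧ ∃ n : ℕ, Module.finrank K E = p ^ n}, E.1

instance maximalPExtension.normal (p : ℕ) (K Ω : Type*) [Field K] [Field Ω] [Algebra K Ω] :
    Normal K (maximalPExtension p K Ω) := by
  have h : ∀ E : {E : IntermediateField K Ω //
      FiniteDimensional K E ∧ IsGalois K E ∧ ∃ n : ℕ, Module.finrank K E = p ^ n},
      Normal K E.1 := fun E => by
    have := E.2.2.1
    infer_instance
  exact IntermediateField.normal_iSup K Ω _

/-- The group `G_K(p) = Gal(K(p)/K)`, i.e. the maximal pro-`p` quotient of the absolute Galois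
group `Gal(Ω/K)` when `Ω` is a separable closure of `K`; it carries the Krull topology. -/
abbrev proPGaloisGroup (p : ℕ) (K Ω : Type*) [Field K] [Field Ω] [Algebra K Ω] : Type _ :=
  Gal(maximalPExtension p K Ω/K)

/-- A finite Galois `p`-extension `E/K` gives, after base change to `L`, a finite Galois
`p`-extension of `L`; hence `K(p) ⊆ L(p)`. -/
theorem mem_maximalPExtension_of_mem {p : ℕ} [Fact p.Prime] {K Ω : Type*} [Field K] [Field Ω]
    [Algebra K Ω] (L : IntermediateField K Ω) {x : Ω} (hx : x ∈ maximalPExtension p K Ω) :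
    x ∈ maximalPExtension p L Ω := by
  suffices h : maximalPExtension p K Ω ≤ (maximalPExtension p L Ω).restrictScalars K from h hx
  refine iSup_le ?_
  rintro ⟨E, hfin, hgal, n, hn⟩
  obtain ⟨T, hT, hTs⟩ := IsGalois.is_separable_splitting_field K E
  have hsplit : (T.map (algebraMap K Ω)).Splits := by
    rw [IsScalarTower.algebraMap_eq K E Ω, ← Polynomial.map_map]
    exact hTs.splits.map _
  have hE : E = IntermediateField.adjoin K (T.rootSet Ω) := by
    have h := (isSplittingField_iff_intermediateField.mp hTs).2
    have h2 := congrArg IntermediateField.lift h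
    rw [IntermediateField.lift_adjoin, IntermediateField.lift_top,
      ← IntermediateField.coe_val, hTs.splits.image_rootSet] at h2
    exact h2.symm
  let M : IntermediateField L Ω := IntermediateField.adjoin L (T.rootSet Ω)
  have hroot : (T.map (algebraMap K L)).rootSet Ω = T.rootSet Ω := by
    simp [Set.ext_iff, Polynomial.mem_rootSet']
  have hM : (T.map (algebraMap K L)).IsSplittingField L M := by
    have := IntermediateField.adjoin_rootSet_isSplittingField (K := L) (L := Ω)
      (p := T.map (algebraMap K L))
      (by rw [Polynomial.map_map, ← IsScalarTower.algebraMap_eq]; exact hsplit)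
    rwa [hroot] at this
  have hMgal : IsGalois L M :=
    IsGalois.of_separable_splitting_field (p := T.map (algebraMap K L)) hT.map
  have hMfin : FiniteDimensional L M :=
    Polynomial.IsSplittingField.finiteDimensional M (T.map (algebraMap K L))
  have hEM : E ≤ M.restrictScalars K := by
    rw [hE, IntermediateField.adjoin_le_iff]
    exact IntermediateField.subset_adjoin L _
  let _ : Algebra E M := (IntermediateField.inclusion hEM).toRingHom.toAlgebra
  have : IsScalarTower K E M := IsScalarTower.of_algebraMap_eq fun _ => rfl
  let f : Gal(M/L) →* Gal(E/K) := IntermediateField.restrictRestrictAlgEquivMapHom K E L M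
  have hf : ∀ (g : Gal(M/L)) (y : E), algebraMap E M (f g y) = g (algebraMap E M y) :=
    fun g y => AlgEquiv.restrictNormal_commutes _ E y
  have hinj : Function.Injective f := by
    refine (injective_iff_map_eq_one f).mpr fun g hg => ?_
    have hle : M ≤ IntermediateField.lift
        (IntermediateField.fixedField (Subgroup.zpowers g)) := by
      refine IntermediateField.adjoin_le_iff.mpr fun y hy => ?_
      have hyE : y ∈ E := hE ▸ IntermediateField.subset_adjoin K _ hy
      refine ⟨⟨y, hEM hyE⟩, ?_, rfl⟩
      have hgy : g ⟨y, hEM hyE⟩ = ⟨y, hEM hyE⟩ := by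
        have := hf g ⟨y, hyE⟩
        rw [hg] at this
        exact this.symm
      intro z
      have hz : z.1 ∈ MulAction.stabilizer Gal(M/L) (⟨y, hEM hyE⟩ : M) :=
        Subgroup.zpowers_le.mpr (MulAction.mem_stabilizer_iff.mpr hgy) z.2
      exact MulAction.mem_stabilizer_iff.mp hz
    ext ⟨y, hy⟩
    obtain ⟨y', hy', hyy⟩ := hle hy
    have h1 := hy' ⟨g, Subgroup.mem_zpowers g⟩
    have h2 : y' = ⟨y, hy⟩ := Subtype.ext hyy
    rw [h2] at h1
    exact congrArg Subtype.val h1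
  have hcard : ∃ m : ℕ, Module.finrank L M = p ^ m := by
    have hp : IsPGroup p Gal(E/K) := IsPGroup.of_card (n := n)
      (by rw [IsGalois.card_aut_eq_finrank, hn])
    rw [← IsGalois.card_aut_eq_finrank]
    exact IsPGroup.iff_card.mp (hp.of_injective f hinj)
  refine le_trans hEM ?_
  intro y hy
  exact (le_iSup (fun E : {E : IntermediateField L Ω //
    FiniteDimensional L E ∧ IsGalois L E ∧ ∃ n : ℕ, Module.finrank L E = p ^ n} => E.1)
    ⟨M, hMfin, hMgal, hcard⟩) hy

/-- The inclusion `K(p) → L(p)` for `K ⊆ L ⊆ Ω`. -/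
def maximalPExtensionInclusion (p : ℕ) [Fact p.Prime] {K Ω : Type*} [Field K] [Field Ω]
    [Algebra K Ω] (L : IntermediateField K Ω) :
    maximalPExtension p K Ω →+* maximalPExtension p L Ω :=
  (algebraMap (maximalPExtension p K Ω) Ω).codRestrict (maximalPExtension p L Ω)
    fun x => mem_maximalPExtension_of_mem L x.2

theorem restrictRestrictAlgEquivMapHom_commutes (F K L E : Type*) [Field F] [Field K] [Field L]
    [Field E] [Algebra F K] [Algebra F L] [Algebra F E] [Algebra K E] [Algebra L E]
    [IsScalarTower F K E] [IsScalarTower F L E] [Normal F K] (g : Gal(E/L)) (x : K) :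
    algebraMap K E (IntermediateField.restrictRestrictAlgEquivMapHom F K L E g x) =
      g (algebraMap K E x) :=
  AlgEquiv.restrictNormal_commutes (MulSemiringAction.toAlgAut Gal(E/L) F E g) K x

/-- The natural homomorphism `G_L(p) → G_K(p)` for `K ⊆ L ⊆ Ω`: an automorphism of `L(p)` over `L`
is restricted to the subfield `K(p)`. -/
noncomputable def proPRestrict (p : ℕ) [Fact p.Prime] {K Ω : Type*} [Field K] [Field Ω]
    [Algebra K Ω] (L : IntermediateField K Ω) : proPGaloisGroup p L Ω →* proPGaloisGroup p K Ω :=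
  letI := (maximalPExtensionInclusion p L).toAlgebra
  haveI : IsScalarTower K (maximalPExtension p K Ω) (maximalPExtension p L Ω) :=
    IsScalarTower.of_algebraMap_eq' rfl
  IntermediateField.restrictRestrictAlgEquivMapHom K (maximalPExtension p K Ω) L
    (maximalPExtension p L Ω)

theorem proPRestrict_apply (p : ℕ) [Fact p.Prime] {K Ω : Type*} [Field K] [Field Ω]
    [Algebra K Ω] (L : IntermediateField K Ω) (g : proPGaloisGroup p L Ω)
    (x : maximalPExtension p K Ω) :
    maximalPExtensionInclusion p L (proPRestrict p L g x) =
      g (maximalPExtensionInclusion p L x) := by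
  let _ := (maximalPExtensionInclusion p L).toAlgebra
  have : IsScalarTower K (maximalPExtension p K Ω) (maximalPExtension p L Ω) :=
    IsScalarTower.of_algebraMap_eq' rfl
  exact restrictRestrictAlgEquivMapHom_commutes K (maximalPExtension p K Ω) L
    (maximalPExtension p L Ω) g x

/-- The `p`-cyclotomic radical extension `CR(F)` inside `Ω`: the compositum of all fields
`F(a^(1/p^m), ζ_(p^m))` with `a ∈ F^×` and `m ≥ 0`. -/
def cyclotomicRadicalExtension (p : ℕ) (F Ω : Type*) [Field F] [Field Ω] [Algebra F Ω] :
    IntermediateField F Ω :=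
  ⨆ (m : ℕ) (a : Fˣ), IntermediateField.adjoin F
    ({x : Ω | x ^ p ^ m = algebraMap F Ω a} ∪ {z : Ω | z ^ p ^ m = 1})

/-- The `p`-cyclotomic character `φ` of `F` on `G_F(p)`: `σ(ξ) = ξ ^ φ(σ)` for all roots of unity
`ξ` of `p`-power order (which lie in `F(p)` when `F` contains a primitive `p`-th root of unity). -/
noncomputable def proPCyclotomicCharacter (p : ℕ) [Fact p.Prime] (F Ω : Type*) [Field F]
    [Field Ω] [Algebra F Ω] : proPGaloisGroup p F Ω →* ℤ_[p]ˣ :=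
  (cyclotomicCharacter (maximalPExtension p F Ω) p).comp
    (MulSemiringAction.toRingAut (proPGaloisGroup p F Ω) (maximalPExtension p F Ω))

/-- The `p`-adic power `g ^ z` of an element of a pro-`p` group: the limit of the integral powers
`g ^ n` as `n → z` in the `p`-adic topology. -/
noncomputable def padicPow {p : ℕ} [Fact p.Prime] {G : Type*} [Group G] [TopologicalSpace G]
    (g : G) (z : ℤ_[p]) : G :=
  limUnder (comap (Int.cast : ℤ → ℤ_[p]) (𝓝 z)) fun n : ℤ => g ^ n

/-- Every element of `K(p)` is fixed by all sufficiently high `p`-power powers in `G_K(p)`. -/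
theorem exists_pow_fix (p : ℕ) [Fact p.Prime] (K Ω : Type*) [Field K] [Field Ω]
    [Algebra K Ω] (x : maximalPExtension p K Ω) :
    ∃ n : ℕ, ∀ g : proPGaloisGroup p K Ω, ∀ m, n ≤ m → (g ^ p ^ m) x = x := by
  let M : IntermediateField K (maximalPExtension p K Ω) :=
    { carrier := {y | ∃ n : ℕ, ∀ g : proPGaloisGroup p K Ω, ∀ m, n ≤ m → (g ^ p ^ m) y = y}
      mul_mem' := by
        rintro a b ⟨n, hn⟩ ⟨n', hn'⟩
        refine ⟨max n n', fun g m hm => ?_⟩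
        rw [map_mul, hn g m (le_trans (le_max_left _ _) hm),
          hn' g m (le_trans (le_max_right _ _) hm)]
      add_mem' := by
        rintro a b ⟨n, hn⟩ ⟨n', hn'⟩
        refine ⟨max n n', fun g m hm => ?_⟩
        rw [map_add, hn g m (le_trans (le_max_left _ _) hm),
          hn' g m (le_trans (le_max_right _ _) hm)]
      algebraMap_mem' := fun r => ⟨0, fun g m _ => AlgEquiv.commutes _ r⟩
      inv_mem' := by
        rintro a ⟨n, hn⟩
        exact ⟨n, fun g m hm => by rw [map_inv₀, hn g m hm]⟩ }
  have hle : maximalPExtension p K Ω ≤ IntermediateField.lift M := by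
    refine iSup_le ?_
    rintro ⟨E, hfin, hgal, n, hn⟩ y hy
    have hE : E ≤ maximalPExtension p K Ω :=
      le_iSup (fun E : {E : IntermediateField K Ω //
        FiniteDimensional K E ∧ IsGalois K E ∧ ∃ n : ℕ, Module.finrank K E = p ^ n} => E.1)
        ⟨E, hfin, hgal, n, hn⟩
    refine ⟨⟨y, hE hy⟩, ⟨n, fun g m hm => ?_⟩, rfl⟩
    let _ : Algebra E (maximalPExtension p K Ω) :=
      (IntermediateField.inclusion hE).toRingHom.toAlgebra
    have : IsScalarTower K E (maximalPExtension p K Ω) :=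
      IsScalarTower.of_algebraMap_eq fun _ => rfl
    have hone : AlgEquiv.restrictNormalHom E (g ^ p ^ m) = 1 := by
      obtain ⟨j, rfl⟩ := Nat.exists_eq_add_of_le hm
      rw [pow_add, pow_mul, map_pow, map_pow, ← hn, ← IsGalois.card_aut_eq_finrank,
        pow_card_eq_one', one_pow]
    have h := AlgEquiv.restrictNormal_commutes (g ^ p ^ m) E ⟨y, hy⟩
    change algebraMap E _ (AlgEquiv.restrictNormalHom E (g ^ p ^ m) ⟨y, hy⟩) = _ at h
    rw [hone] at h
    exact h.symm
  obtain ⟨y, hy, hyx⟩ := hle x.2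
  have : y = x := Subtype.ext hyx
  exact this ▸ hy

/-- The limits defining `p`-adic powers exist in `G_K(p)`. -/
theorem tendsto_padicPow (p : ℕ) [Fact p.Prime] (K Ω : Type*) [Field K] [Field Ω]
    [Algebra K Ω] [Algebra.IsSeparable K Ω] (g : proPGaloisGroup p K Ω) (z : ℤ_[p]) :
    Tendsto (fun n : ℤ => g ^ n) (comap (Int.cast : ℤ → ℤ_[p]) (𝓝 z)) (𝓝 (padicPow g z)) := by
  have : IsGalois K (maximalPExtension p K Ω) := ⟨⟩
  have hne : (comap (Int.cast : ℤ → ℤ_[p]) (𝓝 z)).NeBot :=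
    comap_neBot_iff.mpr fun t ht => by
      obtain ⟨_, hy, n, rfl⟩ := mem_closure_iff_nhds.mp (PadicInt.denseRange_intCast z) t ht
      exact ⟨n, hy⟩
  have hfix : ∀ E : IntermediateField K (maximalPExtension p K Ω), FiniteDimensional K E →
      ∃ n : ℕ, g ^ p ^ n ∈ E.fixingSubgroup := by
    intro E hE
    obtain ⟨s, hs⟩ :=
      IntermediateField.fg_of_fg_toSubalgebra E
        (Subalgebra.fg_of_fg_toSubmodule (Module.Finite.iff_fg.mp hE))
    choose N hN using exists_pow_fix p K Ω
    refine ⟨s.sup N, ?_⟩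
    have hle : E ≤ IntermediateField.fixedField (Subgroup.zpowers (g ^ p ^ (s.sup N))) := by
      rw [← hs]
      refine IntermediateField.adjoin_le_iff.mpr fun y hy z => ?_
      have hz : z.1 ∈ MulAction.stabilizer (proPGaloisGroup p K Ω) y :=
        Subgroup.zpowers_le.mpr (MulAction.mem_stabilizer_iff.mpr
          (hN y g _ (Finset.le_sup hy))) z.2
      exact MulAction.mem_stabilizer_iff.mp hz
    rw [IntermediateField.mem_fixingSubgroup_iff]
    intro y hy
    exact hle hy ⟨_, Subgroup.mem_zpowers _⟩
  refine tendsto_nhds_limUnder ?_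
  obtain ⟨u, -, hu⟩ := isCompact_univ (X := proPGaloisGroup p K Ω)
    (f := map (fun n : ℤ => g ^ n) (comap (Int.cast : ℤ → ℤ_[p]) (𝓝 z))) (by simp)
  refine ⟨u, fun s hs => ?_⟩
  have hs1 : (fun x => u * x) ⁻¹' s ∈ 𝓝 (1 : proPGaloisGroup p K Ω) :=
    (continuous_const_mul u).continuousAt.preimage_mem_nhds (by simpa using hs)
  obtain ⟨E, hE, hEs⟩ := (krullTopology_mem_nhds_one_iff K _ _).mp hs1
  obtain ⟨n, hn⟩ := hfix E hE
  let B : Set ℤ := Int.cast ⁻¹' (Metric.ball z ((p : ℝ) ^ (-(n : ℤ) + 1)))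
  have hp0 : (0 : ℝ) < p := by exact_mod_cast (Fact.out : p.Prime).pos
  have hB : B ∈ comap (Int.cast : ℤ → ℤ_[p]) (𝓝 z) :=
    preimage_mem_comap (Metric.ball_mem_nhds z (zpow_pos hp0 _))
  have hdiff : ∀ a ∈ B, ∀ b ∈ B, (p : ℤ) ^ n ∣ a - b := by
    intro a ha b hb
    rw [← PadicInt.norm_int_le_pow_iff_dvd, PadicInt.norm_le_pow_iff_norm_lt_pow_add_one]
    have h : ((a - b : ℤ) : ℤ_[p]) = (a - z) + (z - b) := by push_cast; ring
    rw [h]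
    refine lt_of_le_of_lt (PadicInt.nonarchimedean _ _) (max_lt ?_ ?_)
    · exact mem_ball_iff_norm.mp ha
    · rw [norm_sub_rev]
      exact mem_ball_iff_norm.mp hb
  have hopen : (fun x => u * x) '' (E.fixingSubgroup : Set (proPGaloisGroup p K Ω)) ∈ 𝓝 u :=
    (isOpenMap_mul_left u _ E.fixingSubgroup_isOpen).mem_nhds
      ⟨1, E.fixingSubgroup.one_mem, mul_one u⟩
  obtain ⟨_, ⟨w, hw, hwa⟩, ⟨a, ha, rfl⟩⟩ :=
    (clusterPt_iff_nonempty.mp hu) hopen (image_mem_map hB)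
  refine mem_map.mpr (mem_of_superset hB fun b hb => ?_)
  obtain ⟨c, hc⟩ := hdiff b hb a ha
  have hb' : g ^ b = u * (w * (g ^ p ^ n) ^ c) := by
    have : b = a + (p ^ n : ℕ) * c := by push_cast; linarith
    rw [this, zpow_add, zpow_mul, zpow_natCast, ← mul_assoc]
    exact congrArg (· * _) hwa.symm
  change g ^ b ∈ s
  rw [hb']
  exact hEs (E.fixingSubgroup.mul_mem hw (E.fixingSubgroup.zpow_mem hn c))

/-!
Write `G = G_F(p)` and let `N = ker φ`. A relation `[σ, τ] τ ^ (1 - φ(σ))` is killed by a character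
`χ : N → μ_{p^m}` exactly when `χ(σ τ σ⁻¹) = σ (χ τ)`, so the closed subgroup generated by the
relations is the common kernel of the `G`-equivariant characters of `N`. By Kummer theory a `p^m`-th
root `y` of an element of `F` gives the equivariant character `τ ↦ τ y / y`, so the relations fix
`CR(F)`. Conversely, the image of `φ` is procyclic and torsion-free because `F` contains the `p`-th
(fourth, if `p = 2`) roots of unity, so the closed subgroup topologically generated by a suitable
`σ` is a complement of `N`. Extending an equivariant character of `N` by `1` on this complement gives
a continuous `1`-cocycle of `G` with values in `F(p)ˣ`. By Hilbert 90 it is of the form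
`g ↦ g y / y`, and `y ^ p^m` lies in `F`, so the character comes from a radical in `CR(F)`.
-/

section PClosedness

variable {p : ℕ} {F Ω : Type*} [Field F] [Field Ω] [Algebra F Ω]

theorem cyclotomicRadicalExtension_le_iff {E : IntermediateField F Ω} :
    cyclotomicRadicalExtension p F Ω ≤ E ↔
      ∀ (x : Ω) (m : ℕ), x ^ p ^ m ∈ (⊥ : IntermediateField F Ω) → x ∈ E := by
  simp only [cyclotomicRadicalExtension, iSup_le_iff, IntermediateField.adjoin_le_iff,
    Set.union_subset_iff]
  refine ⟨fun h x m hx => ?_, fun h m a => ⟨fun x hx => ?_, fun x hx => ?_⟩⟩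
  · by_cases hx0 : x = 0
    · exact hx0 ▸ zero_mem E
    obtain ⟨a, ha⟩ := IntermediateField.mem_bot.mp hx
    have ha0 : a ≠ 0 := by
      rintro rfl
      exact pow_ne_zero _ hx0 (ha.symm.trans (map_zero _))
    exact (h m (Units.mk0 a ha0)).1 ha.symm
  · exact h x m (IntermediateField.mem_bot.mpr ⟨a, Eq.symm hx⟩)
  · exact h x m ((show x ^ p ^ m = 1 from hx) ▸ one_mem _)

theorem pow_apply_eq_of_apply_eq {g : Gal(Ω/F)} {x : Ω} (h : g x = x) (n : ℕ) : (g ^ n) x = x :=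
  (MulAction.stabilizer Gal(Ω/F) x).pow_mem h n

theorem pow_prime_pow_apply_eq_of_le {g : Gal(Ω/F)} {x : Ω} {m n : ℕ} (hmn : m ≤ n)
    (h : (g ^ p ^ m) x = x) : (g ^ p ^ n) x = x := by
  obtain ⟨j, rfl⟩ := Nat.exists_eq_add_of_le hmn
  rw [pow_add, pow_mul]
  exact pow_apply_eq_of_apply_eq h _

variable (p F Ω) in
/-- The subfield of those elements of `Ω` on which every automorphism of `Ω/F` acts with a period
that is a power of `p`. When `Ω/F` is Galois it is `F(p)`, see
`maximalPExtension_eq_pPeriodicField`. -/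
def pPeriodicField : IntermediateField F Ω where
  carrier := {x | ∀ g : Gal(Ω/F), ∃ n : ℕ, (g ^ p ^ n) x = x}
  mul_mem' {a b} ha hb g := by
    obtain ⟨⟨m, hm⟩, n, hn⟩ := And.intro (ha g) (hb g)
    exact ⟨max m n, by rw [map_mul, pow_prime_pow_apply_eq_of_le (le_max_left m n) hm,
      pow_prime_pow_apply_eq_of_le (le_max_right m n) hn]⟩
  add_mem' {a b} ha hb g := by
    obtain ⟨⟨m, hm⟩, n, hn⟩ := And.intro (ha g) (hb g)
    exact ⟨max m n, by rw [map_add, pow_prime_pow_apply_eq_of_le (le_max_left m n) hm,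
      pow_prime_pow_apply_eq_of_le (le_max_right m n) hn]⟩
  algebraMap_mem' r g := ⟨0, AlgEquiv.commutes _ r⟩
  inv_mem' a ha g := (ha g).imp fun n hn => by rw [map_inv₀, hn]

theorem apply_mem_pPeriodicField {x : Ω} (hx : x ∈ pPeriodicField p F Ω) (σ : Gal(Ω/F)) :
    σ x ∈ pPeriodicField p F Ω := fun g => by
  obtain ⟨n, hn⟩ := hx (σ⁻¹ * g * σ)
  have hconj : (σ⁻¹ * g * σ) ^ p ^ n = σ⁻¹ * g ^ p ^ n * σ := by
    simpa only [inv_inv] using conj_pow (a := σ⁻¹) (b := g) (i := p ^ n)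
  rw [hconj] at hn
  exact ⟨n, (inv_smul_eq_iff (g := σ) (a := (g ^ p ^ n) (σ x))).mp hn⟩

instance pPeriodicField.normal [Normal F Ω] : Normal F (pPeriodicField p F Ω) := by
  refine IntermediateField.normal_iff_forall_map_le'.mpr ?_
  rintro σ _ ⟨x, hx, rfl⟩
  exact apply_mem_pPeriodicField hx σ

theorem le_maximalPExtension {E : IntermediateField F Ω} [FiniteDimensional F E] [IsGalois F E]
    {n : ℕ} (hn : Module.finrank F E = p ^ n) : E ≤ maximalPExtension p F Ω :=
  le_iSup (fun E : {E : IntermediateField F Ω //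
    FiniteDimensional F E ∧ IsGalois F E ∧ ∃ n : ℕ, Module.finrank F E = p ^ n} => E.1)
    ⟨E, inferInstance, inferInstance, n, hn⟩

theorem isPGroup_of_le_pPeriodicField [Normal F Ω] {T : IntermediateField F Ω}
    [FiniteDimensional F T] [Normal F T] (hT : T ≤ pPeriodicField p F Ω) :
    IsPGroup p Gal(T/F) := fun g => by
  obtain ⟨s, rfl⟩ := AlgEquiv.restrictNormalHom_surjective (F := F) (K₁ := T) Ω g
  have hperiod (y : T) : ∃ n : ℕ, (s ^ p ^ n) (y : Ω) = y := hT y.2 s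
  choose N hN using hperiod
  let b := Module.finBasis F T
  refine ⟨Finset.univ.sup fun i => N (b i), ?_⟩
  refine AlgEquiv.toLinearMap_injective (b.ext fun i => Subtype.ext ?_)
  rw [← map_pow, AlgEquiv.toLinearMap_apply, AlgEquiv.restrictNormalHom_apply]
  exact pow_prime_pow_apply_eq_of_le
    (Finset.le_sup (f := fun i => N (b i)) (Finset.mem_univ i)) (hN (b i))

variable [Fact p.Prime]

theorem maximalPExtension_le_pPeriodicField :
    maximalPExtension p F Ω ≤ pPeriodicField p F Ω := fun x hx g => by
  obtain ⟨n, hn⟩ := exists_pow_fix p F Ω ⟨x, hx⟩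
  refine ⟨n, ?_⟩
  have hfix := hn (AlgEquiv.restrictNormalHom (maximalPExtension p F Ω) g) n le_rfl
  rw [← map_pow] at hfix
  simpa only [AlgEquiv.restrictNormalHom_apply] using congrArg Subtype.val hfix

theorem maximalPExtension_eq_pPeriodicField [IsGalois F Ω] :
    maximalPExtension p F Ω = pPeriodicField p F Ω := by
  refine le_antisymm maximalPExtension_le_pPeriodicField fun x hx => ?_
  let T := FiniteGaloisIntermediateField.adjoin F {x}
  have hT : T.toIntermediateField ≤ pPeriodicField p F Ω := by
    rw [FiniteGaloisIntermediateField.adjoin_val,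
      IntermediateField.normalClosure_le_iff_of_normal, IntermediateField.adjoin_le_iff]
    exact Set.singleton_subset_iff.mpr hx
  obtain ⟨n, hn⟩ := IsPGroup.iff_card.mp (isPGroup_of_le_pPeriodicField hT)
  rw [IsGalois.card_aut_eq_finrank] at hn
  exact le_maximalPExtension hn (FiniteGaloisIntermediateField.subset_adjoin F {x} rfl)

theorem isOpen_setOf_apply_eq [Algebra.IsIntegral F Ω] (x y : Ω) :
    IsOpen {g : Gal(Ω/F) | g x = y} := by
  refine isOpen_iff_mem_nhds.mpr fun s hs => ?_
  have hopen : IsOpen ((s⁻¹ * ·) ⁻¹' (MulAction.stabilizer Gal(Ω/F) x : Set Gal(Ω/F))) :=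
    (stabilizer_isOpen_of_isIntegral x).preimage (continuous_const_mul s⁻¹)
  refine mem_of_superset (hopen.mem_nhds ?_) fun g hg => ?_
  · simp
  · exact (inv_smul_eq_iff.mp (by rwa [smul_smul] : s⁻¹ • g • x = x)).trans hs

/-- For `g` in `Gal(Ω/F)`, a limit point of the powers `g ^ p ^ n` fixes `F(p)`, so `h` applies to
it. -/
theorem mem_maximalPExtension_of_forall_mem_fixingSubgroup [IsGalois F Ω] {x : Ω}
    (h : ∀ s ∈ (maximalPExtension p F Ω).fixingSubgroup, ∃ n : ℕ, (s ^ p ^ n) x = x) :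
    x ∈ maximalPExtension p F Ω := by
  rw [maximalPExtension_eq_pPeriodicField]
  intro g
  obtain ⟨s, -, hs⟩ := isCompact_univ.exists_mapClusterPt (f := atTop)
    (u := fun n : ℕ => g ^ p ^ n) (by simp)
  have hsfix : s ∈ (maximalPExtension p F Ω).fixingSubgroup := by
    refine (IntermediateField.mem_fixingSubgroup_iff _ _).mpr fun y hy => ?_
    obtain ⟨m, hm⟩ := maximalPExtension_le_pPeriodicField hy g
    obtain ⟨n, hn, hmn⟩ := ((hs.frequently
      ((isOpen_setOf_apply_eq y (s y)).mem_nhds rfl)).and_eventually (eventually_ge_atTop m)).exists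
    exact (show (g ^ p ^ n) y = s y from hn).symm.trans (pow_prime_pow_apply_eq_of_le hmn hm)
  obtain ⟨j, hj⟩ := h s hsfix
  obtain ⟨n, hn⟩ := (hs.frequently (((isOpen_setOf_apply_eq x x).preimage
    (continuous_pow (p ^ j))).mem_nhds hj)).exists
  refine ⟨n + j, ?_⟩
  rw [pow_add, pow_mul]
  exact hn

theorem mem_maximalPExtension_of_le [IsGalois F Ω] {K : IntermediateField F Ω}
    (hK : K ≤ maximalPExtension p F Ω) {x : Ω} (hx : x ∈ maximalPExtension p K Ω) :
    x ∈ maximalPExtension p F Ω := by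
  refine mem_maximalPExtension_of_forall_mem_fixingSubgroup fun s hs => ?_
  let s' : K.fixingSubgroup := ⟨s, IntermediateField.fixingSubgroup_le hK hs⟩
  obtain ⟨n, hn⟩ :=
    maximalPExtension_le_pPeriodicField hx (IntermediateField.fixingSubgroupEquiv K s')
  rw [← map_pow] at hn
  exact ⟨n, hn⟩

theorem mem_maximalPExtension_of_pow_mem [IsGalois F Ω] {ζ : F} (hζ : IsPrimitiveRoot ζ p) {y : Ω}
    (hy : y ^ p ∈ maximalPExtension p F Ω) : y ∈ maximalPExtension p F Ω := by
  by_cases hy0 : y = 0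
  · exact hy0 ▸ zero_mem _
  refine mem_maximalPExtension_of_forall_mem_fixingSubgroup fun g hg => ⟨1, ?_⟩
  have hgy : (g y / y) ^ p = 1 := by
    rw [div_pow, ← map_pow, (IntermediateField.mem_fixingSubgroup_iff _ _).mp hg _ hy,
      div_self (pow_ne_zero _ hy0)]
  obtain ⟨i, -, hi⟩ :=
    (hζ.map_of_injective (algebraMap F Ω).injective).eq_pow_of_pow_eq_one hgy
  rw [← map_pow, eq_div_iff hy0] at hi
  have hpow (m : ℕ) : (g ^ m) y = algebraMap F Ω (ζ ^ i) ^ m * y := by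
    induction m with
    | zero => simp
    | succ m ih => rw [pow_succ', AlgEquiv.mul_apply, ih, map_mul, map_pow, g.commutes, ← hi,
        pow_succ, mul_assoc]
  rw [hpow, pow_one, ← map_pow, pow_right_comm, hζ.pow_eq_one, one_pow, map_one, one_mul]

theorem mem_maximalPExtension_of_pow_prime_pow_mem [IsGalois F Ω] {ζ : F}
    (hζ : IsPrimitiveRoot ζ p) {y : Ω} {m : ℕ} (hy : y ^ p ^ m ∈ maximalPExtension p F Ω) :
    y ∈ maximalPExtension p F Ω := by
  induction m with
  | zero => simpa using hy
  | succ m ih => exact ih (mem_maximalPExtension_of_pow_mem hζ (by rwa [← pow_mul, ← pow_succ]))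

theorem cyclotomicRadicalExtension_le [IsGalois F Ω] {ζ : F} (hζ : IsPrimitiveRoot ζ p) :
    cyclotomicRadicalExtension p F Ω ≤ maximalPExtension p F Ω :=
  cyclotomicRadicalExtension_le_iff.mpr fun _ _ hx =>
    mem_maximalPExtension_of_pow_prime_pow_mem hζ (bot_le (α := IntermediateField F Ω) hx)

theorem hasEnoughRootsOfUnity_maximalPExtension [IsSepClosure F Ω] {ζ : F}
    (hζ : IsPrimitiveRoot ζ p) (n : ℕ) :
    HasEnoughRootsOfUnity (maximalPExtension p F Ω) (p ^ n) := by
  have : IsSepClosed Ω := IsSepClosure.sep_closed F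
  have : NeZero p := ⟨(Fact.out : p.Prime).ne_zero⟩
  have : NeZero ((p : ℕ) : F) := hζ.neZero'
  have : NeZero ((p ^ n : ℕ) : Ω) := ⟨by
    rw [← map_natCast (algebraMap F Ω), Nat.cast_pow]
    exact (map_ne_zero _).mpr (pow_ne_zero n (NeZero.ne _))⟩
  obtain ⟨z, hz⟩ := HasEnoughRootsOfUnity.exists_primitiveRoot Ω (p ^ n)
  have hzmem : z ∈ maximalPExtension p F Ω :=
    mem_maximalPExtension_of_pow_prime_pow_mem hζ (hz.pow_eq_one ▸ one_mem _)
  exact ⟨⟨⟨z, hzmem⟩, IsPrimitiveRoot.of_map_of_injective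
    (f := algebraMap (maximalPExtension p F Ω) Ω) hz
    (algebraMap (maximalPExtension p F Ω) Ω).injective⟩,
    rootsOfUnity.isCyclic _ _⟩

end PClosedness

theorem tendsto_nhds_one_of_forall_eventually_apply_eq {F M ι : Type*} [Field F] [Field M]
    [Algebra F M] {l : Filter ι} {f : ι → Gal(M/F)} (h : ∀ y, ∀ᶠ i in l, f i y = y) :
    Tendsto f l (𝓝 1) := by
  intro s hs
  obtain ⟨E, hE, hEs⟩ := (krullTopology_mem_nhds_one_iff F M s).mp hs
  let b := Module.finBasis F E
  rw [mem_map]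
  filter_upwards [eventually_all.mpr fun j => h (b j)] with i hi
  refine hEs ((IntermediateField.mem_fixingSubgroup_iff _ _).mpr fun y hy => ?_)
  have hext : (f i).toLinearMap ∘ₗ E.val.toLinearMap = E.val.toLinearMap := b.ext hi
  exact LinearMap.congr_fun hext ⟨y, hy⟩

section Restriction

variable {p : ℕ} [Fact p.Prime] {F Ω : Type*} [Field F] [Field Ω] [Algebra F Ω]

theorem continuous_proPRestrict [Algebra.IsAlgebraic F Ω] (L : IntermediateField F Ω) :
    Continuous (proPRestrict p L) := by
  refine continuous_of_continuousAt_one _ ?_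
  rw [ContinuousAt, map_one]
  refine tendsto_nhds_one_of_forall_eventually_apply_eq fun y => ?_
  filter_upwards [(isOpen_setOf_apply_eq (F := L) (maximalPExtensionInclusion p L y)
    (maximalPExtensionInclusion p L y)).mem_nhds rfl] with g hg
  exact (maximalPExtensionInclusion p L).injective ((proPRestrict_apply p L g y).trans hg)

theorem proPRestrict_injective [IsGalois F Ω] {L : IntermediateField F Ω}
    (hL : L ≤ maximalPExtension p F Ω) : Function.Injective (proPRestrict p L) := by
  intro g h hgh
  ext x
  obtain ⟨y, rfl⟩ : ∃ y, maximalPExtensionInclusion p L y = x :=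
    ⟨⟨x, mem_maximalPExtension_of_le hL x.2⟩, rfl⟩
  rw [← proPRestrict_apply, ← proPRestrict_apply, hgh]

theorem isClosedEmbedding_proPRestrict [IsGalois F Ω] {L : IntermediateField F Ω}
    (hL : L ≤ maximalPExtension p F Ω) : Topology.IsClosedEmbedding (proPRestrict p L) := by
  have : IsGalois L (maximalPExtension p L Ω) := ⟨⟩
  exact (continuous_proPRestrict L).isClosedEmbedding (proPRestrict_injective hL)

theorem range_proPRestrict [Normal F Ω] {L : IntermediateField F Ω}
    (hL : L ≤ maximalPExtension p F Ω) :
    (proPRestrict p L).range = (IntermediateField.restrict hL).fixingSubgroup := by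
  ext h
  rw [IntermediateField.mem_fixingSubgroup_iff]
  constructor
  · rintro ⟨g, rfl⟩ x hx
    apply (maximalPExtensionInclusion p L).injective
    rw [proPRestrict_apply]
    exact g.commutes ⟨x, (IntermediateField.mem_restrict hL x).mp hx⟩
  · intro hfix
    obtain ⟨g, rfl⟩ := AlgEquiv.restrictNormalHom_surjective
      (F := F) (K₁ := maximalPExtension p F Ω) Ω h
    have hg : g ∈ L.fixingSubgroup := by
      refine (IntermediateField.mem_fixingSubgroup_iff _ _).mpr fun x hx => ?_
      rw [← AlgEquiv.restrictNormalHom_apply (maximalPExtension p F Ω) g ⟨x, hL hx⟩,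
        hfix ⟨x, hL hx⟩ ((IntermediateField.mem_restrict hL _).mpr hx)]
    have : Normal L Ω := inferInstance
    refine ⟨AlgEquiv.restrictNormalHom (maximalPExtension p L Ω)
      (IntermediateField.fixingSubgroupEquiv L ⟨g, hg⟩), ?_⟩
    ext x
    refine (congrArg Subtype.val (proPRestrict_apply p L _ x)).trans ?_
    rw [AlgEquiv.restrictNormalHom_apply, AlgEquiv.restrictNormalHom_apply]
    rfl

end Restriction

section PrincipalUnits

variable {p : ℕ} [Fact p.Prime]

theorem toZModPow_eq_toZModPow_iff {n : ℕ} {x y : ℤ_[p]} :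
    PadicInt.toZModPow n x = PadicInt.toZModPow n y ↔ (p : ℤ_[p]) ^ n ∣ x - y := by
  rw [← sub_eq_zero, ← map_sub, ← RingHom.mem_ker, PadicInt.ker_toZModPow,
    Ideal.mem_span_singleton]

theorem toZModPow_eq_toZModPow_of_le {m n : ℕ} (hmn : m ≤ n) {x y : ℤ_[p]}
    (h : PadicInt.toZModPow n x = PadicInt.toZModPow n y) :
    PadicInt.toZModPow m x = PadicInt.toZModPow m y := by
  rw [toZModPow_eq_toZModPow_iff] at h ⊢
  exact (pow_dvd_pow _ hmn).trans h

theorem nhds_hasBasis_toZModPow (z : ℤ_[p]) :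
    (𝓝 z).HasBasis (fun _ : ℕ => True)
      fun n => {x | PadicInt.toZModPow n x = PadicInt.toZModPow n z} := by
  have hp : (1 : ℝ) < p := by exact_mod_cast (Fact.out : p.Prime).one_lt
  refine (Metric.nhds_basis_closedBall_pow (inv_pos.mpr (one_pos.trans hp))
    (inv_lt_one_of_one_lt₀ hp)).congr (fun _ => Iff.rfl) fun n _ => Set.ext fun x => ?_
  rw [Metric.mem_closedBall, dist_eq_norm, inv_pow, ← zpow_natCast, ← zpow_neg,
    PadicInt.norm_le_pow_iff_mem_span_pow, Ideal.mem_span_singleton, Set.mem_ofPred_eq,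
    toZModPow_eq_toZModPow_iff]

theorem eventually_toZModPow_intCast_eq (z : ℤ_[p]) (n : ℕ) :
    ∀ᶠ i : ℤ in comap Int.cast (𝓝 z),
      PadicInt.toZModPow n (i : ℤ_[p]) = PadicInt.toZModPow n z :=
  preimage_mem_comap ((nhds_hasBasis_toZModPow z).mem_of_mem trivial)

instance comap_intCast_nhds_neBot (z : ℤ_[p]) : (comap (Int.cast : ℤ → ℤ_[p]) (𝓝 z)).NeBot :=
  comap_neBot fun s hs => by
    obtain ⟨_, hi, i, rfl⟩ := mem_closure_iff_nhds.mp (PadicInt.denseRange_intCast z) s hs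
    exact ⟨i, hi⟩

variable (p) in
/-- The subgroup `1 + p ^ n ℤ_p` of the `p`-adic units, as the kernel of the reduction modulo
`p ^ n` (so that it is the whole group for `n = 0`). -/
noncomputable def principalUnits (n : ℕ) : Subgroup ℤ_[p]ˣ :=
  (Units.map (PadicInt.toZModPow (p := p) n).toMonoidHom).ker

theorem mem_principalUnits {n : ℕ} {u : ℤ_[p]ˣ} :
    u ∈ principalUnits p n ↔ PadicInt.toZModPow n (u : ℤ_[p]) = 1 := by
  rw [principalUnits, MonoidHom.mem_ker, Units.ext_iff]
  rfl

theorem principalUnits_antitone : Antitone (principalUnits p) := fun m n hmn u hu => by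
  rw [mem_principalUnits, ← map_one (PadicInt.toZModPow _)] at hu ⊢
  exact toZModPow_eq_toZModPow_of_le hmn hu

theorem nhds_hasBasis_units_toZModPow (u : ℤ_[p]ˣ) :
    (𝓝 u).HasBasis (fun _ : ℕ => True)
      fun n => {v | PadicInt.toZModPow n (v : ℤ_[p]) = PadicInt.toZModPow n (u : ℤ_[p])} :=
  Units.isOpenEmbedding_val.nhds_eq_comap u ▸ (nhds_hasBasis_toZModPow (u : ℤ_[p])).comap _

variable {k : ℕ} {u : ℤ_[p]ˣ}

/-- Writing `u = 1 + p ^ k * w` with `w` a unit, the order of `1 + p ^ k * w` modulo `p ^ (e + k)`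
is known for natural numbers `w` prime to `p`. The hypothesis `k + 2 ≤ p * k` says that `1 ≤ k`, and
that `2 ≤ k` if `p = 2`. -/
theorem orderOf_map_toZModPow (hk : k + 2 ≤ p * k) (hu : u ∈ principalUnits p k)
    (hu' : u ∉ principalUnits p (k + 1)) (e : ℕ) :
    orderOf (Units.map (PadicInt.toZModPow (p := p) (e + k)).toMonoidHom u) = p ^ e := by
  have hp : p.Prime := Fact.out
  rw [mem_principalUnits, ← map_one (PadicInt.toZModPow _), toZModPow_eq_toZModPow_iff] at hu hu'
  obtain ⟨w, hw⟩ := hu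
  have hpw : ¬ (p : ℤ_[p]) ∣ w := fun h => hu' (by
    rw [hw, pow_succ]; exact mul_dvd_mul_left _ h)
  obtain ⟨a, haw⟩ : ∃ a : ℕ, PadicInt.toZModPow (e + k + 1) w =
      PadicInt.toZModPow (e + k + 1) (a : ℤ_[p]) :=
    ⟨_, (ZMod.natCast_zmod_val _).symm.trans (map_natCast _ _).symm⟩
  have hpa : ¬ (p : ℤ) ∣ (a : ℤ) := fun h => hpw <| by
    have hdvd : (p : ℤ_[p]) ∣ w - a :=
      (dvd_pow_self _ (Nat.succ_ne_zero _)).trans (toZModPow_eq_toZModPow_iff.mp haw)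
    refine (dvd_sub_left ?_).mp hdvd
    exact_mod_cast map_dvd (Int.castRingHom ℤ_[p]) h
  have hmod : PadicInt.toZModPow (e + k) (u : ℤ_[p]) = 1 + p ^ k * (a : ℤ) := by
    rw [show (u : ℤ_[p]) = 1 + p ^ k * w by linear_combination hw, map_add, map_one, map_mul,
      toZModPow_eq_toZModPow_of_le (Nat.le_succ (e + k)) haw, map_pow, map_natCast, map_natCast,
      Int.cast_natCast]
  rw [← orderOf_units, ← ZMod.orderOf_one_add_mul_prime_pow hp k (by rintro rfl; omega) hk a hpa e]
  exact congrArg orderOf hmod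

theorem zpow_mem_principalUnits_iff (hk : k + 2 ≤ p * k) (hu : u ∈ principalUnits p k)
    (hu' : u ∉ principalUnits p (k + 1)) {e : ℕ} {n : ℤ} :
    u ^ n ∈ principalUnits p (e + k) ↔ (p : ℤ) ^ e ∣ n := by
  rw [principalUnits, MonoidHom.mem_ker, map_zpow, ← orderOf_dvd_iff_zpow_eq_one,
    orderOf_map_toZModPow hk hu hu', Nat.cast_pow]

theorem comap_zpow_nhds_one_le (hk : k + 2 ≤ p * k) (hu : u ∈ principalUnits p k)
    (hu' : u ∉ principalUnits p (k + 1)) :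
    comap (fun n : ℤ => u ^ n) (𝓝 1) ≤ comap (Int.cast : ℤ → ℤ_[p]) (𝓝 0) := by
  rw [((nhds_hasBasis_units_toZModPow 1).comap _).le_basis_iff
    ((nhds_hasBasis_toZModPow 0).comap _)]
  refine fun e _ => ⟨e + k, trivial, fun n hn => ?_⟩
  have hmem : u ^ n ∈ principalUnits p (e + k) := mem_principalUnits.mpr (by simpa using hn)
  refine toZModPow_eq_toZModPow_iff.mpr ?_
  rw [sub_zero, PadicInt.pow_p_dvd_int_iff]
  exact (zpow_mem_principalUnits_iff hk hu hu').mp hmem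

theorem card_ker_unitsMap (hk : k ≠ 0) (e : ℕ) :
    Nat.card (ZMod.unitsMap (pow_dvd_pow p (Nat.le_add_left k e))).ker = p ^ e := by
  have hp : p.Prime := Fact.out
  have : NeZero p := ⟨hp.ne_zero⟩
  have h := Subgroup.card_mul_index
    (ZMod.unitsMap (pow_dvd_pow p (Nat.le_add_left k e))).ker
  rw [Subgroup.index_ker, MonoidHom.range_eq_top.mpr (ZMod.unitsMap_surjective _),
    Subgroup.card_top, Nat.card_eq_fintype_card (α := (ZMod _)ˣ),
    Nat.card_eq_fintype_card (α := (ZMod _)ˣ), ZMod.card_units_eq_totient,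
    ZMod.card_units_eq_totient, Nat.totient_prime_pow hp (Nat.pos_of_ne_zero hk),
    Nat.totient_prime_pow hp (Nat.add_pos_right e (Nat.pos_of_ne_zero hk))] at h
  refine Nat.eq_of_mul_eq_mul_right
    (Nat.mul_pos (pow_pos hp.pos (k - 1)) (Nat.sub_pos_of_lt hp.one_lt)) (h.trans ?_)
  rw [Nat.add_sub_assoc (Nat.one_le_iff_ne_zero.mpr hk), pow_add, mul_assoc]

/-- Modulo `p ^ (e + k)`, the powers of `u` and the image of `1 + p ^ k ℤ_p` are groups of the same
order `p ^ e`. -/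
theorem principalUnits_le_topologicalClosure_zpowers (hk : k + 2 ≤ p * k)
    (hu : u ∈ principalUnits p k) (hu' : u ∉ principalUnits p (k + 1)) :
    principalUnits p k ≤ (Subgroup.zpowers u).topologicalClosure := by
  have hp : p.Prime := Fact.out
  have : NeZero p := ⟨hp.ne_zero⟩
  intro v hv
  refine (mem_closure_iff_nhds_basis' (nhds_hasBasis_units_toZModPow v)).mpr fun e _ => ?_
  let r := Units.map (PadicInt.toZModPow (p := p) (e + k)).toMonoidHom
  have hr {w : ℤ_[p]ˣ} (hw : w ∈ principalUnits p k) :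
      r w ∈ (ZMod.unitsMap (pow_dvd_pow p (Nat.le_add_left k e))).ker := by
    rw [MonoidHom.mem_ker, Units.ext_iff, ZMod.unitsMap_val, Units.val_one,
      ← mem_principalUnits.mp hw]
    exact PadicInt.cast_toZModPow _ _ (Nat.le_add_left k e) _
  have hzpowers : Subgroup.zpowers (r u) =
      (ZMod.unitsMap (pow_dvd_pow p (Nat.le_add_left k e))).ker := by
    refine Subgroup.eq_of_le_of_card_ge (Subgroup.zpowers_le.mpr (hr hu)) ?_
    rw [Nat.card_zpowers, orderOf_map_toZModPow hk hu hu',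
      card_ker_unitsMap (by rintro rfl; omega)]
  obtain ⟨i, hi⟩ : r v ∈ Subgroup.zpowers (r u) := hzpowers ▸ hr hv
  exact ⟨u ^ i, toZModPow_eq_toZModPow_of_le (Nat.le_add_right e k)
    (congrArg Units.val ((map_zpow r u i).trans hi)), Subgroup.zpow_mem_zpowers u i⟩

end PrincipalUnits

section PadicPower

variable {p : ℕ} [Fact p.Prime] {K Ω : Type*} [Field K] [Field Ω] [Algebra K Ω]

theorem tendsto_pow_prime_pow_nhds_one (g : proPGaloisGroup p K Ω) :
    Tendsto (fun n : ℕ => g ^ p ^ n) atTop (𝓝 1) :=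
  tendsto_nhds_one_of_forall_eventually_apply_eq fun y =>
    (exists_pow_fix p K Ω y).elim fun n hn => (eventually_ge_atTop n).mono (hn g)

theorem tendsto_zpow_nhds_one (g : proPGaloisGroup p K Ω) :
    Tendsto (fun n : ℤ => g ^ n) (comap (Int.cast : ℤ → ℤ_[p]) (𝓝 0)) (𝓝 1) := by
  refine tendsto_nhds_one_of_forall_eventually_apply_eq fun y => ?_
  obtain ⟨n, hn⟩ := exists_pow_fix p K Ω y
  filter_upwards [eventually_toZModPow_intCast_eq 0 n] with i hi
  rw [toZModPow_eq_toZModPow_iff, sub_zero, PadicInt.pow_p_dvd_int_iff] at hi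
  obtain ⟨c, rfl⟩ := hi
  rw [zpow_mul]
  exact (MulAction.stabilizer (proPGaloisGroup p K Ω) y).zpow_mem
    (by exact_mod_cast hn g n le_rfl) c

variable [Algebra.IsSeparable K Ω]

theorem exists_forall_pow_prime_pow_mem {V : Subgroup (proPGaloisGroup p K Ω)} [V.Normal]
    (hV : IsOpen (V : Set (proPGaloisGroup p K Ω))) :
    ∃ e : ℕ, ∀ g : proPGaloisGroup p K Ω, g ^ p ^ e ∈ V := by
  have : IsGalois K (maximalPExtension p K Ω) := ⟨⟩
  have : Finite (proPGaloisGroup p K Ω ⧸ V) := Subgroup.quotient_finite_of_isOpen V hV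
  have hP : IsPGroup p (proPGaloisGroup p K Ω ⧸ V) := by
    rintro ⟨g⟩
    obtain ⟨n, hn⟩ := ((tendsto_pow_prime_pow_nhds_one g).eventually
      (hV.mem_nhds V.one_mem)).exists
    exact ⟨n, (QuotientGroup.eq_one_iff _).mpr hn⟩
  obtain ⟨e, he⟩ := IsPGroup.iff_card.mp hP
  refine ⟨e, fun g => (QuotientGroup.eq_one_iff _).mp ?_⟩
  rw [QuotientGroup.mk_pow, ← he, pow_card_eq_one']

theorem padicPow_inv_mul_zpow_mem {V : Subgroup (proPGaloisGroup p K Ω)}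
    (hV : IsOpen (V : Set (proPGaloisGroup p K Ω))) {g : proPGaloisGroup p K Ω} {e : ℕ}
    (hg : g ^ p ^ e ∈ V) {z : ℤ_[p]} {n : ℤ}
    (hn : PadicInt.toZModPow e (n : ℤ_[p]) = PadicInt.toZModPow e z) :
    (padicPow g z)⁻¹ * g ^ n ∈ V := by
  have hnhds : {x | (padicPow g z)⁻¹ * x ∈ V} ∈ 𝓝 (padicPow g z) :=
    (hV.preimage (continuous_const_mul _)).mem_nhds (by simp)
  obtain ⟨i, hiV, hi⟩ := ((tendsto_padicPow p K Ω g z).eventually hnhds |>.and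
    (eventually_toZModPow_intCast_eq z e)).exists
  obtain ⟨c, hc⟩ : (p : ℤ) ^ e ∣ n - i := by
    rw [← PadicInt.pow_p_dvd_int_iff, Int.cast_sub]
    exact toZModPow_eq_toZModPow_iff.mp (hn.trans hi.symm)
  have hpow : g ^ (n - i) ∈ V := by
    rw [hc, zpow_mul]
    exact V.zpow_mem (by exact_mod_cast hg) c
  simpa only [mul_assoc, ← zpow_add, add_sub_cancel] using V.mul_mem hiV hpow

theorem conj_padicPow (h g : proPGaloisGroup p K Ω) (z : ℤ_[p]) :
    h * padicPow g z * h⁻¹ = padicPow (h * g * h⁻¹) z := by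
  have : IsGalois K (maximalPExtension p K Ω) := ⟨⟩
  have hconj : Continuous fun x : proPGaloisGroup p K Ω => h * x * h⁻¹ := by fun_prop
  refine tendsto_nhds_unique ?_ (tendsto_padicPow p K Ω (h * g * h⁻¹) z)
  exact ((hconj.tendsto _).comp (tendsto_padicPow p K Ω g z)).congr fun n => (conj_zpow).symm

end PadicPower

section Complement

variable {G : Type*} [Group G] [TopologicalSpace G] [IsTopologicalGroup G] [CompactSpace G]
  [T2Space G]

theorem isComplement'_ker_topologicalClosure_zpowers {p : ℕ} [Fact p.Prime] {φ : G →* ℤ_[p]ˣ}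
    (hφ : Continuous φ) {σ : G}
    (hσ : Tendsto (fun n : ℤ => σ ^ n) (comap (Int.cast : ℤ → ℤ_[p]) (𝓝 0)) (𝓝 1))
    {k : ℕ} (hk : k + 2 ≤ p * k) (hrange : φ.range ≤ principalUnits p k)
    (hφσ : φ σ ∉ principalUnits p (k + 1)) :
    φ.ker.IsComplement' (Subgroup.zpowers σ).topologicalClosure := by
  have hφσk : φ σ ∈ principalUnits p k := hrange ⟨σ, rfl⟩
  refine Subgroup.isComplement'_of_disjoint_and_mul_eq_univ (Subgroup.disjoint_def.mpr ?_) ?_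
  · intro g hg hgσ
    have hne : (comap (fun n : ℤ => σ ^ n) (𝓝 g)).NeBot := comap_neBot fun s hs => by
      obtain ⟨_, hns, n, rfl⟩ := mem_closure_iff_nhds.mp hgσ s hs
      exact ⟨n, hns⟩
    have hφg : Tendsto (fun n : ℤ => φ σ ^ n) (comap (fun n : ℤ => σ ^ n) (𝓝 g)) (𝓝 1) :=
      (MonoidHom.mem_ker.mp hg ▸ (hφ.tendsto g).comp tendsto_comap).congr fun n => map_zpow φ σ n
    exact tendsto_nhds_unique tendsto_comap (hσ.mono_left
      ((map_le_iff_le_comap.mp hφg).trans (comap_zpow_nhds_one_le hk hφσk hφσ)))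
  · have himage : φ.range ≤ (Subgroup.zpowers σ).topologicalClosure.map φ := by
      refine hrange.trans ((principalUnits_le_topologicalClosure_zpowers hk hφσk hφσ).trans ?_)
      refine Subgroup.topologicalClosure_minimal _ ?_ ?_
      · exact Subgroup.zpowers_le.mpr
          ⟨σ, Subgroup.le_topologicalClosure _ (Subgroup.mem_zpowers σ), rfl⟩
      · exact ((Subgroup.isClosed_topologicalClosure _).isCompact.image hφ).isClosed
    refine Set.eq_univ_of_forall fun g => ?_
    obtain ⟨z, hz, hzg⟩ := himage ⟨g, rfl⟩
    refine Set.mem_mul.mpr ⟨g * z⁻¹, ?_, z, hz, inv_mul_cancel_right g z⟩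
    exact MonoidHom.mem_ker.mpr (by rw [map_mul, map_inv, hzg, mul_inv_cancel])

theorem exists_isClosed_isComplement'_ker {p : ℕ} [Fact p.Prime] {φ : G →* ℤ_[p]ˣ}
    (hφ : Continuous φ)
    (hG : ∀ σ : G, Tendsto (fun n : ℤ => σ ^ n) (comap (Int.cast : ℤ → ℤ_[p]) (𝓝 0)) (𝓝 1))
    {k : ℕ} (hk : k + 2 ≤ p * k) (hrange : φ.range ≤ principalUnits p k) :
    ∃ Z : Subgroup G, IsClosed (Z : Set G) ∧ φ.ker.IsComplement' Z := by
  by_cases hall : ∀ n, φ.range ≤ principalUnits p n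
  · have hker : φ.ker = ⊤ := (Subgroup.eq_top_iff' _).mpr fun g => MonoidHom.mem_ker.mpr <|
      Units.ext <| PadicInt.ext_of_toZModPow.mp fun n => by
        rw [mem_principalUnits.mp (hall n ⟨g, rfl⟩), Units.val_one, map_one]
    exact ⟨⊥, isClosed_singleton, hker ▸ Subgroup.isComplement'_top_bot⟩
  · obtain ⟨j, hj, hj'⟩ :
        ∃ j, φ.range ≤ principalUnits p j ∧ ¬ φ.range ≤ principalUnits p (j + 1) := by
      by_contra! hsucc
      exact hall fun n => n.rec (hrange.trans (principalUnits_antitone k.zero_le)) hsucc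
    have hkj : k ≤ j := by
      by_contra! hjk
      exact hj' (hrange.trans (principalUnits_antitone hjk))
    obtain ⟨_, ⟨σ, rfl⟩, hσ⟩ := SetLike.not_le_iff_exists.mp hj'
    refine ⟨_, Subgroup.isClosed_topologicalClosure _,
      isComplement'_ker_topologicalClosure_zpowers hφ (hG σ) ?_ hj hσ⟩
    nlinarith [(Fact.out : p.Prime).two_le]

theorem continuous_isComplement_equiv {S T : Set G} (h : Subgroup.IsComplement S T)
    (hS : IsClosed S) (hT : IsClosed T) : Continuous h.equiv := by
  have : CompactSpace S := isCompact_iff_compactSpace.mp hS.isCompact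
  have : CompactSpace T := isCompact_iff_compactSpace.mp hT.isCompact
  have hsymm : Continuous h.equiv.symm :=
    (continuous_subtype_val.comp continuous_fst).mul (continuous_subtype_val.comp continuous_snd)
  exact hsymm.homeoOfEquivCompactToT2.symm.continuous

end Complement

/-- `N` acts trivially on the values of `χ` because these commute. -/
theorem isMulCocycle₁_comp_isComplement'_equiv {G A : Type*} [Group G] [CommGroup A]
    [MulDistribMulAction G A] {N Z : Subgroup G} [N.Normal] (h : N.IsComplement' Z)
    {χ : N →* A} (hχ : ∀ g τ, χ (MulAut.conjNormal g τ) = g • χ τ) :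
    groupCohomology.IsMulCocycle₁ fun g => χ (h.equiv g).1 := by
  have hN (n τ : N) : (n : G) • χ τ = χ τ := by
    have hconj : MulAut.conjNormal (n : G) τ = n * τ * n⁻¹ :=
      Subtype.ext (MulAut.conjNormal_apply _ _)
    rw [← hχ, hconj, map_mul, map_mul, map_inv, mul_right_comm, mul_inv_cancel, one_mul]
  intro g g'
  obtain ⟨n, z, hnz⟩ : ∃ (n : N) (z : Z), h.equiv g = (n, z) := ⟨_, _, rfl⟩
  obtain ⟨n', z', hnz'⟩ : ∃ (n' : N) (z' : Z), h.equiv g' = (n', z') := ⟨_, _, rfl⟩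
  have hg : g = n * z := (Equiv.eq_symm_apply _).mpr hnz
  have hg' : g' = n' * z' := (Equiv.eq_symm_apply _).mpr hnz'
  have hmul : h.equiv (g * g') = (n * MulAut.conjNormal (z : G) n', z * z') := by
    refine (Equiv.eq_symm_apply _).mp ?_
    rw [Subgroup.IsComplement.equiv_symm_apply, hg, hg']
    simp only [Subgroup.coe_mul, MulAut.conjNormal_apply]
    group
  simp only [hmul, hnz, hnz']
  rw [hg, mul_smul, ← hχ, hN, map_mul, mul_comm]

section Hilbert90

theorem isMulCocycle₁_mul_right {G A : Type*} [Group G] [CommGroup A] [MulDistribMulAction G A]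
    {c : G → A} (hc : groupCohomology.IsMulCocycle₁ c) {n : G} (hn : c n = 1) (g : G) :
    c (g * n) = c g := by
  rw [hc, hn, smul_one, one_mul]

theorem smul_isMulCocycle₁_apply {G A : Type*} [Group G] [CommGroup A] [MulDistribMulAction G A]
    {c : G → A} (hc : groupCohomology.IsMulCocycle₁ c) {N : Subgroup G} [N.Normal]
    (hN : ∀ n ∈ N, c n = 1) {n : G} (hn : n ∈ N) (g : G) : n • c g = c g := by
  have hconj : g⁻¹ * n * g ∈ N := by
    simpa only [inv_inv] using ‹N.Normal›.conj_mem n hn g⁻¹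
  calc n • c g = c (n * g) := by rw [hc, hN n hn, mul_one]
    _ = c (g * (g⁻¹ * n * g)) := by rw [mul_assoc, mul_inv_cancel_left]
    _ = c g := isMulCocycle₁_mul_right hc (hN _ hconj) g

variable {F M : Type*} [Field F] [Field M] [Algebra F M]

theorem smul_unitsMap_algebraMap {E : Type*} [Field E] [Algebra F E] [Algebra E M]
    [IsScalarTower F E M] [Normal F E] (g : Gal(M/F)) (x : Eˣ) :
    g • Units.map (algebraMap E M : E →* M) x =
      Units.map (algebraMap E M : E →* M) (AlgEquiv.restrictNormalHom E g • x) :=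
  Units.ext (AlgEquiv.restrictNormal_commutes g E x).symm

variable [IsGalois F M]

theorem isMulCoboundary₁_of_forall_mem_fixingSubgroup {c : Gal(M/F) → Mˣ}
    (hc : groupCohomology.IsMulCocycle₁ c) (T : IntermediateField F M) [FiniteDimensional F T]
    [Normal F T] (hT : ∀ g ∈ T.fixingSubgroup, c g = 1) : groupCohomology.IsMulCoboundary₁ c := by
  have : T.fixingSubgroup.Normal := T.restrictNormalHom_ker ▸ MonoidHom.normal_ker _
  let ι : Tˣ →* Mˣ := Units.map (algebraMap T M : T →* M)
  have hι : Function.Injective ι := Units.map_injective (algebraMap T M).injective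
  have hres {g h : Gal(M/F)}
      (hgh : AlgEquiv.restrictNormalHom T g = AlgEquiv.restrictNormalHom T h) : c g = c h := by
    have hmem : h⁻¹ * g ∈ T.fixingSubgroup := by
      rw [← IntermediateField.restrictNormalHom_ker, MonoidHom.mem_ker, map_mul, map_inv, hgh,
        inv_mul_cancel]
    rw [← isMulCocycle₁_mul_right hc (hT _ hmem) h, mul_inv_cancel_left]
  have hvalues (g : Gal(M/F)) : ∃ x : Tˣ, ι x = c g := by
    have hfixed : (c g : M) ∈ IntermediateField.fixedField T.fixingSubgroup := fun n =>
      congrArg Units.val (smul_isMulCocycle₁_apply hc hT n.2 g)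
    rw [InfiniteGalois.fixedField_fixingSubgroup] at hfixed
    exact ⟨Units.mk0 ⟨c g, hfixed⟩ fun h => (c g).ne_zero (congrArg Subtype.val h), Units.ext rfl⟩
  choose d hd using hvalues
  choose s hs using AlgEquiv.restrictNormalHom_surjective (F := F) (K₁ := T) M
  obtain ⟨x, hx⟩ := groupCohomology.isMulCoboundary₁_of_isMulCocycle₁_of_aut_to_units
    (fun g => d (s g)) fun g h => hι <| by
      have hcoc := hc (s g) (s h)
      rw [← hd (s h), smul_unitsMap_algebraMap, hs] at hcoc
      rw [hd, map_mul, hd, ← hcoc]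
      exact hres (by rw [map_mul, hs, hs, hs])
  refine ⟨ι x, fun g => ?_⟩
  rw [smul_unitsMap_algebraMap, ← map_div, hx, hd, hres (hs _)]

theorem isMulCoboundary₁_of_isLocallyConstant {c : Gal(M/F) → Mˣ}
    (hc : groupCohomology.IsMulCocycle₁ c) (hc' : IsLocallyConstant c) :
    groupCohomology.IsMulCoboundary₁ c := by
  have hnhds : {g | c g = 1} ∈ 𝓝 1 :=
    (hc'.isOpen_fiber 1).mem_nhds (groupCohomology.map_one_of_isMulCocycle₁ hc)
  obtain ⟨T, hfin, hnormal, hT⟩ := (krullTopology_mem_nhds_one_iff_of_normal F M _).mp hnhds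
  exact isMulCoboundary₁_of_forall_mem_fixingSubgroup hc T fun g hg => hT hg

end Hilbert90

open scoped IsMulCommutative in
theorem exists_monoidHom_units_apply_ne_one {H M : Type*} [Group H] [CommMonoid M]
    {n : ℕ} [NeZero n] [HasEnoughRootsOfUnity M n] {S : Subgroup H} [S.Normal] [S.FiniteIndex]
    (hcomm : commutator H ≤ S) (hpow : ∀ h : H, h ^ n ∈ S) {x : H} (hx : x ∉ S) :
    ∃ χ : H →* Mˣ, S ≤ χ.ker ∧ χ x ≠ 1 := by
  have : IsMulCommutative (H ⧸ S) :=
    Subgroup.Normal.quotient_commutative_iff_commutator_le.mpr hcomm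
  have hexp : Monoid.exponent (H ⧸ S) ∣ n := Monoid.exponent_dvd_of_forall_pow_eq_one fun q =>
    q.inductionOn' fun h => (QuotientGroup.eq_one_iff _).mpr (hpow h)
  have : HasEnoughRootsOfUnity M (Monoid.exponent (H ⧸ S)) := HasEnoughRootsOfUnity.of_dvd M hexp
  obtain ⟨χ, hχ⟩ := CommGroup.exists_apply_ne_one_of_hasEnoughRootsOfUnity (H ⧸ S) M
    (mt (QuotientGroup.eq_one_iff x).mp hx)
  refine ⟨χ.comp (QuotientGroup.mk' S), fun s hs => ?_, hχ⟩
  rw [MonoidHom.mem_ker, MonoidHom.comp_apply, QuotientGroup.mk'_apply,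
    (QuotientGroup.eq_one_iff s).mpr hs, map_one]

theorem isLocallyConstant_of_isOpen_ker {G H : Type*} [Group G] [TopologicalSpace G]
    [ContinuousMul G] [Group H] {χ : G →* H} (hχ : IsOpen (χ.ker : Set G)) :
    IsLocallyConstant χ := by
  refine (IsLocallyConstant.iff_eventually_eq _).mpr fun g => ?_
  have hcoset : {h | g⁻¹ * h ∈ χ.ker} ∈ 𝓝 g :=
    (hχ.preimage (continuous_const_mul g⁻¹)).mem_nhds (by simp)
  filter_upwards [hcoset] with h hh
  rwa [MonoidHom.mem_ker, map_mul, map_inv, inv_mul_eq_one, eq_comm] at hh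

theorem exists_smul_div_eq_of_isLocallyConstant {F M : Type*} [Field F] [Field M] [Algebra F M]
    [IsGalois F M] {N Z : Subgroup Gal(M/F)} [N.Normal] (hN : IsClosed (N : Set Gal(M/F)))
    (hZ : IsClosed (Z : Set Gal(M/F))) (hNZ : N.IsComplement' Z) {χ : N →* Mˣ}
    (hχ : IsLocallyConstant χ) (hχσ : ∀ σ τ, χ (MulAut.conjNormal σ τ) = σ • χ τ)
    {n : ℕ} (hχn : ∀ τ, χ τ ^ n = 1) :
    ∃ y : Mˣ, (y : M) ^ n ∈ (⊥ : IntermediateField F M) ∧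
      ∀ τ : N, (τ : Gal(M/F)) • y / y = χ τ := by
  have hlc : IsLocallyConstant fun g => χ (hNZ.equiv g).1 :=
    hχ.comp_continuous (continuous_fst.comp (continuous_isComplement_equiv hNZ hN hZ))
  obtain ⟨y, hy⟩ := isMulCoboundary₁_of_isLocallyConstant
    (isMulCocycle₁_comp_isComplement'_equiv hNZ hχσ) hlc
  refine ⟨y, InfiniteGalois.mem_bot_iff_fixed _ |>.mpr fun g => ?_, fun τ => ?_⟩
  · have hg : g • y ^ n = y ^ n := by rw [smul_pow', ← div_eq_one, ← div_pow, hy, hχn]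
    exact congrArg Units.val hg
  · exact (hy τ).trans (congrArg χ (hNZ.equiv_fst_eq_self_of_mem_of_one_mem Z.one_mem τ.2))

theorem mem_fixedField_zpowers_iff {F M : Type*} [Field F] [Field M] [Algebra F M] {g : Gal(M/F)}
    {x : M} : x ∈ IntermediateField.fixedField (Subgroup.zpowers g) ↔ g x = x := by
  rw [IntermediateField.mem_fixedField_iff]
  exact Subgroup.zpowers_le (H := MulAction.stabilizer Gal(M/F) x)

theorem mem_fixingSubgroup_cyclotomicRadicalExtension_iff {p : ℕ} {F M : Type*} [Field F] [Field M]
    [Algebra F M] {g : Gal(M/F)} :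
    g ∈ (cyclotomicRadicalExtension p F M).fixingSubgroup ↔
      ∀ (y : M) (m : ℕ), y ^ p ^ m ∈ (⊥ : IntermediateField F M) → g y = y := by
  rw [← Subgroup.zpowers_le, ← IntermediateField.le_iff_le, cyclotomicRadicalExtension_le_iff]
  simp only [mem_fixedField_zpowers_iff]

section CyclotomicCharacter

variable {p : ℕ} [Fact p.Prime] {F M : Type*} [Field F] [Field M] [Algebra F M]

variable (p F M) in
/-- The `p`-adic cyclotomic character of `Gal(M/F)`, for an extension `M/F` containing all roots
of unity of `p`-power order. For `M = F(p)` it unfolds to `proPCyclotomicCharacter`. -/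
noncomputable def galCyclotomicCharacter : Gal(M/F) →* ℤ_[p]ˣ :=
  (cyclotomicCharacter M p).comp (MulSemiringAction.toRingAut Gal(M/F) M)

theorem commutator_ker_le {S : Subgroup (galCyclotomicCharacter p F M).ker} {e : ℕ}
    (hrel : ∀ (σ : Gal(M/F)) (τ : (galCyclotomicCharacter p F M).ker) {n : ℤ},
      PadicInt.toZModPow e (n : ℤ_[p]) =
        PadicInt.toZModPow e (1 - (galCyclotomicCharacter p F M σ : ℤ_[p])) →
      MulAut.conjNormal σ τ * τ⁻¹ * τ ^ n ∈ S) :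
    commutator (galCyclotomicCharacter p F M).ker ≤ S := by
  refine Subgroup.commutator_le.mpr fun a _ b _ => ?_
  have hconj : MulAut.conjNormal (a : Gal(M/F)) b = a * b * a⁻¹ :=
    Subtype.ext (MulAut.conjNormal_apply _ _)
  have h := hrel (a : Gal(M/F)) b (n := 0) (by
    rw [MonoidHom.mem_ker.mp a.2, Units.val_one, sub_self, Int.cast_zero])
  rwa [zpow_zero, mul_one, hconj] at h

variable [∀ i, HasEnoughRootsOfUnity M (p ^ i)]

theorem smul_eq_zpow_of_toZModPow_eq {g : Gal(M/F)} {t : Mˣ} {m : ℕ} (ht : t ^ p ^ m = 1) {i : ℤ}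
    (hi : PadicInt.toZModPow m (i : ℤ_[p]) =
      PadicInt.toZModPow m (galCyclotomicCharacter p F M g : ℤ_[p])) :
    g • t = t ^ i := by
  have hval : ((PadicInt.toZModPow m (galCyclotomicCharacter p F M g : ℤ_[p])).val : ℤ) =
      i % (p ^ m : ℕ) := by
    rw [← hi, map_intCast, ZMod.val_intCast]
  rw [zpow_eq_zpow_emod' i ht, ← hval, zpow_natCast]
  exact Units.ext (cyclotomicCharacter.spec p (MulSemiringAction.toRingAut Gal(M/F) M g) (t : M)
    (by rw [← Units.val_pow_eq_pow_val, ht, Units.val_one]))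

theorem smul_eq_self_of_galCyclotomicCharacter_mem_principalUnits {g : Gal(M/F)} {m : ℕ}
    (hg : galCyclotomicCharacter p F M g ∈ principalUnits p m) {t : Mˣ} (ht : t ^ p ^ m = 1) :
    g • t = t := by
  rw [smul_eq_zpow_of_toZModPow_eq (i := 1) ht, zpow_one]
  rw [mem_principalUnits.mp hg, Int.cast_one, map_one]

theorem galCyclotomicCharacter_mem_principalUnits_iff {g : Gal(M/F)} {ζ : Mˣ} {m : ℕ}
    (hζ : IsPrimitiveRoot ζ (p ^ m)) :
    galCyclotomicCharacter p F M g ∈ principalUnits p m ↔ g • ζ = ζ := by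
  refine ⟨fun hg => smul_eq_self_of_galCyclotomicCharacter_mem_principalUnits hg hζ.pow_eq_one,
    fun hg => ?_⟩
  obtain ⟨i, hi⟩ :=
    (eventually_toZModPow_intCast_eq (galCyclotomicCharacter p F M g : ℤ_[p]) m).exists
  rw [smul_eq_zpow_of_toZModPow_eq hζ.pow_eq_one hi, ← mul_inv_eq_one, ← zpow_sub_one,
    hζ.zpow_eq_one_iff_dvd] at hg
  rw [mem_principalUnits, ← hi, map_intCast, ← sub_eq_zero, ← Int.cast_one, ← Int.cast_sub,
    ZMod.intCast_zmod_eq_zero_iff_dvd]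
  exact hg

theorem range_galCyclotomicCharacter_le_principalUnits {m : ℕ}
    (hF : ∃ ζ : F, IsPrimitiveRoot ζ (p ^ m)) :
    (galCyclotomicCharacter p F M).range ≤ principalUnits p m := by
  have : NeZero (p ^ m) := ⟨pow_ne_zero _ (Fact.out : p.Prime).ne_zero⟩
  obtain ⟨ζ, hζ⟩ := hF
  rintro _ ⟨g, rfl⟩
  have hζM := (hζ.isUnit_unit NeZero.out).map_of_injective
    (Units.map_injective (f := (algebraMap F M : F →* M)) (algebraMap F M).injective)
  exact (galCyclotomicCharacter_mem_principalUnits_iff hζM).mpr (Units.ext (g.commutes ζ))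

theorem smul_eq_self_of_mem_ker {τ : Gal(M/F)} (hτ : τ ∈ (galCyclotomicCharacter p F M).ker)
    {t : Mˣ} {m : ℕ} (ht : t ^ p ^ m = 1) : τ • t = t :=
  smul_eq_self_of_galCyclotomicCharacter_mem_principalUnits
    (MonoidHom.mem_ker.mp hτ ▸ one_mem _) ht

theorem mem_ker_galCyclotomicCharacter {τ : Gal(M/F)}
    (hτ : ∀ t : Mˣ, ∀ m, t ^ p ^ m = 1 → τ • t = t) : τ ∈ (galCyclotomicCharacter p F M).ker := by
  refine MonoidHom.mem_ker.mpr (Units.ext (PadicInt.ext_of_toZModPow.mp fun m => ?_))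
  have : NeZero (p ^ m) := ⟨pow_ne_zero _ (Fact.out : p.Prime).ne_zero⟩
  obtain ⟨ζ, hζ⟩ := HasEnoughRootsOfUnity.exists_primitiveRoot M (p ^ m)
  have hζu := hζ.isUnit_unit NeZero.out
  rw [Units.val_one, map_one, ← mem_principalUnits,
    galCyclotomicCharacter_mem_principalUnits_iff hζu]
  exact hτ _ m hζu.pow_eq_one

theorem map_commutator_mul_zpow_eq_one_iff {χ : (galCyclotomicCharacter p F M).ker →* Mˣ}
    {σ : Gal(M/F)} {τ : (galCyclotomicCharacter p F M).ker} {m : ℕ} (hτ : χ τ ^ p ^ m = 1) {n : ℤ}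
    (hn : PadicInt.toZModPow m (n : ℤ_[p]) =
      PadicInt.toZModPow m (1 - (galCyclotomicCharacter p F M σ : ℤ_[p]))) :
    χ (MulAut.conjNormal σ τ * τ⁻¹ * τ ^ n) = 1 ↔ χ (MulAut.conjNormal σ τ) = σ • χ τ := by
  have hσ : σ • χ τ = χ τ ^ (1 - n) := smul_eq_zpow_of_toZModPow_eq hτ <| by
    rw [Int.cast_sub, Int.cast_one, map_sub, hn, map_sub, sub_sub_cancel]
  rw [map_mul, map_mul, map_inv, map_zpow, hσ, zpow_sub, zpow_one, mul_assoc,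
    ← eq_inv_iff_mul_eq_one, mul_inv, inv_inv]

theorem smul_div_self_pow_eq_one {y : Mˣ} {n : ℕ} (hy : (y : M) ^ n ∈ (⊥ : IntermediateField F M))
    (g : Gal(M/F)) : (g • y / y) ^ n = 1 := by
  obtain ⟨a, ha⟩ := IntermediateField.mem_bot.mp hy
  have hfix : g • y ^ n = y ^ n :=
    Units.ext (by change g ((y ^ n : Mˣ) : M) = _; rw [Units.val_pow_eq_pow_val, ← ha, g.commutes])
  rw [div_pow, ← smul_pow', hfix, div_self']

/-- The Kummer character `τ ↦ τ y / y` of a `p^m`-th root `y` of an element of `F`, on the group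
fixing all roots of unity of `p`-power order. -/
noncomputable def kummerCharacter (y : Mˣ) {m : ℕ}
    (hy : (y : M) ^ p ^ m ∈ (⊥ : IntermediateField F M)) :
    (galCyclotomicCharacter p F M).ker →* Mˣ where
  toFun τ := (τ : Gal(M/F)) • y / y
  map_one' := by rw [Subgroup.coe_one, one_smul, div_self']
  map_mul' τ τ' := by
    have hfix : (τ : Gal(M/F)) • ((τ' : Gal(M/F)) • y / y) = (τ' : Gal(M/F)) • y / y :=
      smul_eq_self_of_mem_ker τ.2 (smul_div_self_pow_eq_one hy _)
    rw [Subgroup.coe_mul, mul_smul, mul_comm, ← hfix, smul_div', div_mul_div_cancel]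

section

variable {y : Mˣ} {m : ℕ} (hy : (y : M) ^ p ^ m ∈ (⊥ : IntermediateField F M))
include hy

theorem kummerCharacter_pow_eq_one (τ) : kummerCharacter y hy τ ^ p ^ m = 1 :=
  smul_div_self_pow_eq_one hy τ

theorem apply_eq_of_kummerCharacter_eq_one {τ} (hτ : kummerCharacter y hy τ = 1) :
    (τ : Gal(M/F)) y = y :=
  congrArg Units.val (div_eq_one.mp hτ)

theorem kummerCharacter_conjNormal (σ : Gal(M/F)) (τ) :
    kummerCharacter y hy (MulAut.conjNormal σ τ) = σ • kummerCharacter y hy τ := by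
  have hc : (τ : Gal(M/F)) • (σ⁻¹ • y / y) = σ⁻¹ • y / y :=
    smul_eq_self_of_mem_ker τ.2 (smul_div_self_pow_eq_one hy _)
  have hτ : (τ : Gal(M/F)) • σ⁻¹ • y / σ⁻¹ • y = (τ : Gal(M/F)) • y / y := by
    rw [smul_div', div_eq_div_iff_mul_eq_mul] at hc
    rw [div_eq_div_iff_mul_eq_mul, hc, mul_comm]
  simp only [kummerCharacter, MonoidHom.coe_mk, OneHom.coe_mk]
  rw [← hτ, smul_div', smul_inv_smul, MulAut.conjNormal_apply, mul_smul, mul_smul]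

end

section

variable {y : M} {m : ℕ} (hy : y ^ p ^ m ∈ (⊥ : IntermediateField F M))
include hy

theorem pow_prime_pow_apply_eq_of_pow_mem_bot (τ : (galCyclotomicCharacter p F M).ker) :
    ((τ : Gal(M/F)) ^ p ^ m) y = y := by
  obtain rfl | hy0 := eq_or_ne y 0
  · exact map_zero _
  lift y to Mˣ using hy0.isUnit
  exact apply_eq_of_kummerCharacter_eq_one hy (τ := τ ^ p ^ m)
    ((map_pow _ _ _).trans (kummerCharacter_pow_eq_one hy τ))

theorem commutator_mul_zpow_apply_eq_of_pow_mem_bot {σ : Gal(M/F)}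
    {τ : (galCyclotomicCharacter p F M).ker} {n : ℤ}
    (hn : PadicInt.toZModPow m (n : ℤ_[p]) =
      PadicInt.toZModPow m (1 - (galCyclotomicCharacter p F M σ : ℤ_[p]))) :
    (MulAut.conjNormal σ τ * τ⁻¹ * τ ^ n : (galCyclotomicCharacter p F M).ker).1 y = y := by
  obtain rfl | hy0 := eq_or_ne y 0
  · exact map_zero _
  lift y to Mˣ using hy0.isUnit
  exact apply_eq_of_kummerCharacter_eq_one hy <|
    (map_commutator_mul_zpow_eq_one_iff (kummerCharacter_pow_eq_one hy τ) hn).mpr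
      (kummerCharacter_conjNormal hy σ τ)

end

theorem fixingSubgroup_cyclotomicRadicalExtension_le [IsGalois F M] {Z : Subgroup Gal(M/F)}
    (hZ : IsClosed (Z : Set Gal(M/F))) (hφZ : (galCyclotomicCharacter p F M).ker.IsComplement' Z)
    {V : Subgroup Gal(M/F)} [V.Normal] (hV : IsOpen (V : Set Gal(M/F))) {e : ℕ}
    (he : ∀ g : Gal(M/F), g ^ p ^ e ∈ V)
    (hrel : ∀ (σ : Gal(M/F)) (τ : (galCyclotomicCharacter p F M).ker) {n : ℤ},
      PadicInt.toZModPow e (n : ℤ_[p]) =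
        PadicInt.toZModPow e (1 - (galCyclotomicCharacter p F M σ : ℤ_[p])) →
      MulAut.conjNormal σ τ * τ⁻¹ * τ ^ n ∈ V.subgroupOf (galCyclotomicCharacter p F M).ker) :
    (cyclotomicRadicalExtension p F M).fixingSubgroup ≤ V := by
  have : Finite (Gal(M/F) ⧸ V) := Subgroup.quotient_finite_of_isOpen V hV
  have : V.FiniteIndex := Subgroup.finiteIndex_of_finite_quotient
  have : NeZero p := ⟨(Fact.out : p.Prime).ne_zero⟩
  intro τ hτ
  rw [mem_fixingSubgroup_cyclotomicRadicalExtension_iff] at hτ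
  set φ := galCyclotomicCharacter p F M
  have hτφ : τ ∈ φ.ker := mem_ker_galCyclotomicCharacter fun t m ht =>
    Units.ext (hτ t m (by rw [← Units.val_pow_eq_pow_val, ht]; exact one_mem _))
  by_contra hτV
  obtain ⟨χ, hχV, hχτ⟩ := exists_monoidHom_units_apply_ne_one (M := M) (n := p ^ e)
    (S := V.subgroupOf φ.ker) (x := (⟨τ, hτφ⟩ : φ.ker)) (commutator_ker_le hrel) (fun h => he h) hτV
  have hχe (τ : φ.ker) : χ τ ^ p ^ e = 1 := by
    rw [← map_pow]
    exact hχV (he τ)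
  have hχσ (σ : Gal(M/F)) (τ : φ.ker) : χ (MulAut.conjNormal σ τ) = σ • χ τ := by
    obtain ⟨n, hn⟩ := (eventually_toZModPow_intCast_eq (1 - (φ σ : ℤ_[p])) e).exists
    exact (map_commutator_mul_zpow_eq_one_iff (hχe τ) hn).mp (hχV (hrel σ τ hn))
  have hlc : IsLocallyConstant χ := isLocallyConstant_of_isOpen_ker
    (Subgroup.isOpen_mono hχV (hV.preimage continuous_subtype_val))
  have hclosed : IsClosed (φ.ker : Set Gal(M/F)) :=
    isClosed_singleton.preimage (cyclotomicCharacter.continuous p F M)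
  obtain ⟨y, hy, hyχ⟩ := exists_smul_div_eq_of_isLocallyConstant hclosed hZ hφZ hlc hχσ hχe
  exact hχτ (by rw [← hyχ, div_eq_one]; exact Units.ext (hτ y e hy))

end CyclotomicCharacter

theorem mem_of_forall_isOpen_normal_mem {G : Type*} [Group G] [TopologicalSpace G]
    [IsTopologicalGroup G] [CompactSpace G] [TotallyDisconnectedSpace G] {H : Subgroup G}
    [H.Normal] (hH : IsClosed (H : Set G)) {g : G}
    (hg : ∀ V : Subgroup G, V.Normal → IsOpen (V : Set G) → H ≤ V → g ∈ V) : g ∈ H := by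
  have hsInf := ProfiniteGrp.closedSubgroup_eq_sInf_open ⟨H, hH⟩
  change H = _ at hsInf
  rw [hsInf, Subgroup.mem_sInf]
  rintro U ⟨hU, hHU : H ≤ U⟩
  have : Finite (G ⧸ U) := Subgroup.quotient_finite_of_isOpen U hU
  have : U.FiniteIndex := Subgroup.finiteIndex_of_finite_quotient
  refine U.normalCore_le (hg _ U.normalCore_normal ?_ (Subgroup.normal_le_normalCore.mpr hHU))
  exact Subgroup.isOpen_of_isClosed_of_finiteIndex _
    (U.normalCore_isClosed (Subgroup.isClosed_of_isOpen _ hU))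

theorem restrict_cyclotomicRadicalExtension {p : ℕ} {F Ω : Type*} [Field F] [Field Ω] [Algebra F Ω]
    {M : IntermediateField F Ω} (hM : cyclotomicRadicalExtension p F Ω ≤ M) :
    IntermediateField.restrict hM = cyclotomicRadicalExtension p F M := by
  refine le_antisymm (fun x hx => ?_) (cyclotomicRadicalExtension_le_iff.mpr fun x m hx => ?_)
  · have hlift : cyclotomicRadicalExtension p F Ω ≤
        IntermediateField.lift (cyclotomicRadicalExtension p F M) := by
      refine cyclotomicRadicalExtension_le_iff.mpr fun y m hy => ?_
      have hyM : y ∈ M := cyclotomicRadicalExtension_le_iff.mp hM y m hy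
      obtain ⟨a, ha⟩ := IntermediateField.mem_bot.mp hy
      exact (IntermediateField.mem_lift (⟨y, hyM⟩ : M)).mpr <|
        cyclotomicRadicalExtension_le_iff.mp le_rfl _ m
          (IntermediateField.mem_bot.mpr ⟨a, Subtype.ext ha⟩)
    exact (IntermediateField.mem_lift x).mp
      (hlift ((IntermediateField.mem_restrict hM x).mp hx))
  · obtain ⟨a, ha⟩ := IntermediateField.mem_bot.mp hx
    exact (IntermediateField.mem_restrict hM x).mpr <|
      cyclotomicRadicalExtension_le_iff.mp le_rfl _ m
        (IntermediateField.mem_bot.mpr ⟨a, congrArg Subtype.val ha⟩)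

section Relations

variable {p : ℕ} [Fact p.Prime] {F Ω : Type*} [Field F] [Field Ω] [Algebra F Ω]

variable (p F Ω) in
/-- The elements `[σ, τ] τ ^ (1 - φ(σ))` of `G_F(p)` with `τ ∈ ker φ`, where `φ` is the cyclotomic
character. -/
def cyclotomicRelations : Set (proPGaloisGroup p F Ω) :=
  {g | ∃ σ τ : proPGaloisGroup p F Ω, τ ∈ (proPCyclotomicCharacter p F Ω).ker ∧
    g = (σ * τ * σ⁻¹ * τ⁻¹) * padicPow τ (1 - (proPCyclotomicCharacter p F Ω σ : ℤ_[p]))}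

variable [Algebra.IsSeparable F Ω]

theorem conj_mem_cyclotomicRelations {g : proPGaloisGroup p F Ω}
    (hg : g ∈ cyclotomicRelations p F Ω) (h : proPGaloisGroup p F Ω) :
    h * g * h⁻¹ ∈ cyclotomicRelations p F Ω := by
  obtain ⟨σ, τ, hτ, rfl⟩ := hg
  refine ⟨h * σ * h⁻¹, h * τ * h⁻¹, (MonoidHom.normal_ker _).conj_mem τ hτ h, ?_⟩
  have hφ : proPCyclotomicCharacter p F Ω (h * σ * h⁻¹) = proPCyclotomicCharacter p F Ω σ := by
    rw [map_mul, map_mul, map_inv, mul_right_comm, mul_inv_cancel, one_mul]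
  rw [hφ, ← conj_padicPow]
  group

theorem normal_closure_cyclotomicRelations :
    (Subgroup.closure (cyclotomicRelations p F Ω)).Normal := by
  have hconj : Group.conjugatesOfSet (cyclotomicRelations p F Ω) = cyclotomicRelations p F Ω := by
    refine Set.Subset.antisymm (fun g hg => ?_) Group.subset_conjugatesOfSet
    obtain ⟨a, ha, hag⟩ := Group.mem_conjugatesOfSet_iff.mp hg
    obtain ⟨h, rfl⟩ := isConj_iff.mp hag
    exact conj_mem_cyclotomicRelations ha h
  rw [← hconj]
  exact Subgroup.normalClosure_normal

theorem commutator_mul_padicPow_mem_iff {V : Subgroup (proPGaloisGroup p F Ω)}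
    (hV : IsOpen (V : Set (proPGaloisGroup p F Ω))) {m : ℕ} {σ : proPGaloisGroup p F Ω}
    {τ : (galCyclotomicCharacter p F (maximalPExtension p F Ω)).ker}
    (hτ : (τ : proPGaloisGroup p F Ω) ^ p ^ m ∈ V) {z : ℤ_[p]} {n : ℤ}
    (hn : PadicInt.toZModPow m (n : ℤ_[p]) = PadicInt.toZModPow m z) :
    σ * τ * σ⁻¹ * (τ : proPGaloisGroup p F Ω)⁻¹ * padicPow (τ : proPGaloisGroup p F Ω) z ∈ V ↔
      MulAut.conjNormal σ τ * τ⁻¹ * τ ^ n ∈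
        V.subgroupOf (galCyclotomicCharacter p F (maximalPExtension p F Ω)).ker := by
  rw [Subgroup.mem_subgroupOf, ← V.mul_mem_cancel_right (padicPow_inv_mul_zpow_mem hV hτ hn),
    mul_assoc, mul_inv_cancel_left]
  simp only [Subgroup.coe_mul, Subgroup.coe_inv, Subgroup.coe_zpow, MulAut.conjNormal_apply]

variable [∀ i, HasEnoughRootsOfUnity (maximalPExtension p F Ω) (p ^ i)]

theorem cyclotomicRelations_subset_fixingSubgroup :
    cyclotomicRelations p F Ω ⊆
      (cyclotomicRadicalExtension p F (maximalPExtension p F Ω)).fixingSubgroup := by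
  rintro _ ⟨σ, τ, hτ, rfl⟩
  refine mem_fixingSubgroup_cyclotomicRadicalExtension_iff.mpr fun y m hy => ?_
  lift τ to (galCyclotomicCharacter p F (maximalPExtension p F Ω)).ker using hτ
  obtain ⟨n, hn⟩ := (eventually_toZModPow_intCast_eq
    (1 - (galCyclotomicCharacter p F (maximalPExtension p F Ω) σ : ℤ_[p])) m).exists
  have hopen : IsOpen
      (MulAction.stabilizer (proPGaloisGroup p F Ω) y : Set (proPGaloisGroup p F Ω)) :=
    isOpen_setOf_apply_eq y y
  exact (commutator_mul_padicPow_mem_iff hopen (pow_prime_pow_apply_eq_of_pow_mem_bot hy τ) hn).mpr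
    (commutator_mul_zpow_apply_eq_of_pow_mem_bot hy hn)

theorem fixingSubgroup_cyclotomicRadicalExtension_eq_topologicalClosure {k : ℕ} (hk : k + 2 ≤ p * k)
    (hF : ∃ ζ : F, IsPrimitiveRoot ζ (p ^ k)) :
    (cyclotomicRadicalExtension p F (maximalPExtension p F Ω)).fixingSubgroup =
      (Subgroup.closure (cyclotomicRelations p F Ω)).topologicalClosure := by
  have : IsGalois F (maximalPExtension p F Ω) := ⟨⟩
  have hnormal : (Subgroup.closure (cyclotomicRelations p F Ω)).topologicalClosure.Normal :=
    have := normal_closure_cyclotomicRelations (p := p) (F := F) (Ω := Ω)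
    Subgroup.is_normal_topologicalClosure _
  refine le_antisymm (fun τ hτ => ?_) (Subgroup.topologicalClosure_minimal _
    ((Subgroup.closure_le _).mpr cyclotomicRelations_subset_fixingSubgroup)
    (InfiniteGalois.fixingSubgroup_isClosed _))
  refine mem_of_forall_isOpen_normal_mem (Subgroup.isClosed_topologicalClosure _)
    fun V hVnormal hV hRV => ?_
  obtain ⟨Z, hZ, hφZ⟩ := exists_isClosed_isComplement'_ker
    (cyclotomicCharacter.continuous p F (maximalPExtension p F Ω)) tendsto_zpow_nhds_one hk
    (range_galCyclotomicCharacter_le_principalUnits hF)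
  obtain ⟨e, he⟩ := exists_forall_pow_prime_pow_mem hV
  refine fixingSubgroup_cyclotomicRadicalExtension_le hZ hφZ hV he (fun σ τ n hn => ?_) hτ
  exact (commutator_mul_padicPow_mem_iff hV (he τ) hn).mp
    (hRV (Subgroup.le_topologicalClosure _ (Subgroup.subset_closure ⟨σ, τ, τ.2, rfl⟩)))

end Relations

theorem exists_isPrimitiveRoot_prime_pow {p : ℕ} [Fact p.Prime] {F : Type*} [Field F]
    (hodd : p ≠ 2 → ∃ ζ : F, IsPrimitiveRoot ζ p) (htwo : p = 2 → ∃ ζ : F, IsPrimitiveRoot ζ 4) :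
    ∃ k, k + 2 ≤ p * k ∧ ∃ ζ : F, IsPrimitiveRoot ζ (p ^ k) := by
  obtain rfl | hp := eq_or_ne p 2
  · exact ⟨2, le_rfl, htwo rfl⟩
  · have hp2 : 2 ≤ p := (Fact.out : p.Prime).two_le
    exact ⟨1, by lia, (pow_one p).symm ▸ hodd hp⟩

theorem mainTheorem8_general (p : ℕ) [Fact p.Prime] (F Fsep : Type*) [Field F] [Field Fsep]
    [Algebra F Fsep] [IsSepClosure F Fsep]
    (hodd : p ≠ 2 → ∃ ζ : F, IsPrimitiveRoot ζ p)
    (htwo : p = 2 → ∃ ζ : F, IsPrimitiveRoot ζ 4) :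
    Topology.IsClosedEmbedding (proPRestrict p (cyclotomicRadicalExtension p F Fsep)) ∧
    (proPRestrict p (cyclotomicRadicalExtension p F Fsep)).range =
      (Subgroup.closure (cyclotomicRelations p F Fsep)).topologicalClosure := by
  obtain ⟨k, hk, ζ, hζ⟩ := exists_isPrimitiveRoot_prime_pow hodd htwo
  have hζp : IsPrimitiveRoot (ζ ^ p ^ (k - 1)) p :=
    hζ.pow (pow_pos (Fact.out : p.Prime).pos k) (pow_sub_one_mul (by rintro rfl; lia) p).symm
  have : ∀ i, HasEnoughRootsOfUnity (maximalPExtension p F Fsep) (p ^ i) :=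
    hasEnoughRootsOfUnity_maximalPExtension hζp
  have hle := cyclotomicRadicalExtension_le (Ω := Fsep) hζp
  refine ⟨isClosedEmbedding_proPRestrict hle, ?_⟩
  rw [range_proPRestrict hle, restrict_cyclotomicRadicalExtension]
  exact fixingSubgroup_cyclotomicRadicalExtension_eq_topologicalClosure hk ⟨ζ, hζ⟩

theorem mainTheorem8 (p : ℕ) [Fact p.Prime] (F Fsep : Type*) [Field F] [Field Fsep]
    [Algebra F Fsep] [IsSepClosure F Fsep]
    (hodd : p ≠ 2 → ∃ ζ : F, IsPrimitiveRoot ζ p)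
    (htwo : p = 2 → ∃ ζ : F, IsPrimitiveRoot ζ 4)
    (k : ℕ) (hk : ∃ ζ : F, IsPrimitiveRoot ζ (p ^ k))
    (hk' : ¬ ∃ ζ : F, IsPrimitiveRoot ζ (p ^ (k + 1))) :
    Topology.IsClosedEmbedding (proPRestrict p (cyclotomicRadicalExtension p F Fsep)) ∧
    (proPRestrict p (cyclotomicRadicalExtension p F Fsep)).range =
      (Subgroup.closure {g : proPGaloisGroup p F Fsep |
        ∃ σ τ : proPGaloisGroup p F Fsep, τ ∈ (proPCyclotomicCharacter p F Fsep).ker ∧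
          g = (σ * τ * σ⁻¹ * τ⁻¹) * padicPow τ (1 - (proPCyclotomicCharacter p F Fsep σ : ℤ_[p]))
        }).topologicalClosure :=
  mainTheorem8_general p F Fsep hodd htwo
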